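/- For positive integers $k$ and $n$, let the starburst graph $S_n^{(k)}$ be the graph on $kn+k$ vertices obtained from the complete graph $K_k$ by attaching $n$ pendant edges to each of its vertices. A graph $G$ is Ramsey for a graph $H$ if every two-coloring of the edges of $G$ contains a monochromatic copy of $H$ (as a not necessarily induced subgraph), and the size Ramsey number $\hat r(H)$ is the minimum number of edges of a finite graph that is Ramsey for $H$. Then: (1) There are absolute constants $c, C > 0$ such that for every $k \ge 2$ there is $n_0 = n_0(k)$ with $$c\,k^3 n^2 \le \hat r(S_n^{(k)}) \le C\,k^3 n^2 \qquad\text{for all } n \ge n_0,$$ that is, $\hat r(S_n^{(k)}) = \Theta(k^3n^2)$ for every fixed $k \ge 2$ and all sufficiently large $n$. (2) For every $k \ge 4$ there is $n_1 = n_1(k)$ such that $\hat r(S_n^{(k)}) \le 10^5 k^3 n^2$ for all $n \ge n_1$. (3) For every $k \ge 2$ and every $n \ge 1$, $$\hat r(S_n^{(k)}) \ge \binom{k-1}{2}(n+k-1)(kn+k-1).$$ -/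

import Mathlib

/-- The starburst graph: the complete graph on the `k` vertices `Sum.inl i`, with `n` pendant edges
at each of them; the leaves attached to `Sum.inl i` are `Sum.inr (i, l)` for `l : Fin n`. -/
def starburst (k n : ℕ) : SimpleGraph (Fin k ⊕ (Fin k × Fin n)) where
  Adj
    | Sum.inl i, Sum.inl j => i ≠ j
    | Sum.inl i, Sum.inr b => i = b.1
    | Sum.inr a, Sum.inl j => a.1 = j
    | Sum.inr _, Sum.inr _ => False
  symm := ⟨by
    rintro (i | a) (j | b) h
    · exact Ne.symm h
    · exact Eq.symm h
    · exact Eq.symm h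
    · exact h⟩
  loopless := ⟨by
    rintro (i | a) h
    · exact h rfl
    · exact h⟩

/-- `G` is Ramsey for `H`: every two-coloring of the edges of `G` contains a monochromatic copy
of `H` (a not necessarily induced subgraph isomorphic to `H`). -/
def IsRamseyFor {V W : Type*} (G : SimpleGraph V) (H : SimpleGraph W) : Prop :=
  ∀ χ : G.EdgeLabeling (Fin 2), ∃ color : Fin 2, H.IsContained (χ.labelGraph color)

/-- The size Ramsey number of `H`: the minimum number of edges of a (finite) graph that is Ramsey
for `H`. -/
noncomputable def sizeRamsey {W : Type*} (H : SimpleGraph W) : ℕ :=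
  sInf {m : ℕ | ∃ (N : ℕ) (G : SimpleGraph (Fin N)), IsRamseyFor G H ∧ G.edgeSet.ncard = m}

/-! Lower bound. If every colour-0 edge lies inside one of `k - 1` vertex classes and every colour-1
edge joins two classes, colour 1 contains no `K_k`, so it suffices that no class contain a
starburst. A class fails to do so if it has at most `kn + k - 1` vertices, or if all its inner
degrees are below `n + k - 1`. The classes are built by deleting `kn + k - 1` vertices of
successively largest degree. Either the remaining maximum degree is below `j(n + k - 1)`, and a
partition into `j` classes with the fewest inner edges finishes, or the deletion has cost at least
`(kn + k - 1) j (n + k - 1)` edges. Summing over `j ≤ k - 2` gives the binomial coefficient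
(`exists_partition_starburst_free`). It vanishes for `k = 2`, where a colouring based on high-degree
vertices is used instead.

Upper bound. The host is a quasirandom graph of density `p = 1/(16k)` on about `800 k² n` vertices,
hence with `O(k³ n²)` edges. In any two-colouring some colour, say red, gives degree at least `kn +
k` to a third of the vertices. A red `K_k` among these extends greedily to a red starburst.
Otherwise red is `K_k`-free there, and regularity with Turán's theorem gives a linear-sized set `c`
and a set `Y`, of proportion at least `1/(4k)`, with few red edges between them
(`exists_sparse_pair`). So half of `c` has at least `p|Y|/2` blue neighbours in `Y`. Inside this
half, quasirandomness provides a clique of size `2^(2k)` with all codegrees in `Y` at most `4p²|Y|`.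
Ramsey's theorem yields a blue `K_k`, and as `k · 4p² = p/4`, discarding common neighbours leaves
its vertices disjoint blue neighbourhoods of size at least `p|Y|/4`
(`exists_starburst_of_isQuasirandom`).

The host is an explicit blow-up, shown to be quasirandom by a second-moment computation
(`isQuasirandom_crossSumGraph`). -/

open Finset

/-! ### Lower bounds from explicit colourings. -/

section LowerBound

theorem SimpleGraph.ncard_edgeSet {V : Type*} [Fintype V] (G : SimpleGraph V)
    [Fintype G.edgeSet] : G.edgeSet.ncard = #G.edgeFinset := by
  rw [edgeFinset, Set.ncard_eq_toFinset_card']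

theorem SimpleGraph.ncard_edgeSet_deleteIncidenceSet {V : Type*} [Fintype V] (G : SimpleGraph V)
    [DecidableRel G.Adj] (v : V) :
    (G.deleteIncidenceSet v).edgeSet.ncard + G.degree v = G.edgeSet.ncard := by
  classical
  rw [ncard_edgeSet, ncard_edgeSet, card_edgeFinset_deleteIncidenceSet]
  exact Nat.sub_add_cancel (G.degree_le_card_edgeFinset v)

open Classical in
/-- Removing `m` vertices of largest degree one after the other. -/
theorem SimpleGraph.exists_greedy_removal {V : Type*} [Fintype V] (m : ℕ) :
    ∀ G : SimpleGraph V, ∃ (A : Finset V) (G' : SimpleGraph V), #A ≤ m ∧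
      (∀ x y, G'.Adj x y ↔ G.Adj x y ∧ x ∉ A ∧ y ∉ A) ∧
      G'.edgeSet.ncard + m * G'.maxDegree ≤ G.edgeSet.ncard := by
  induction m with
  | zero => exact fun G ↦ ⟨∅, G, by simp⟩
  | succ m ih =>
    intro G
    rcases isEmpty_or_nonempty V with hV | hV
    · refine ⟨∅, G, by simp, by simp, ?_⟩
      have : G.maxDegree = 0 := by simp
      rw [this]; simp
    · obtain ⟨v, hv⟩ := G.exists_maximal_degree_vertex
      obtain ⟨A, G', hA, hadj, hc⟩ := ih (G.deleteIncidenceSet v)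
      have hle : G' ≤ G := fun x y h ↦ G.deleteIncidenceSet_le v ((hadj x y).1 h).1
      have hmax : G'.maxDegree ≤ G.maxDegree := maxDegree_mono hle
      refine ⟨insert v A, G', (card_insert_le _ _).trans (by lia), fun x y ↦ ?_, ?_⟩
      · rw [hadj, deleteIncidenceSet_adj]
        simp only [mem_insert, not_or]
        tauto
      · have h3 := G.ncard_edgeSet_deleteIncidenceSet v
        have h4 : (m + 1) * G'.maxDegree = m * G'.maxDegree + G'.maxDegree := by ring
        lia

/-- The edges of `G` inside the classes of the vertex partition given by `f`. -/
def SimpleGraph.withinClasses {V ι : Type*} (G : SimpleGraph V) (f : V → ι) : SimpleGraph V where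
  Adj x y := G.Adj x y ∧ f x = f y
  symm := ⟨fun _ _ h ↦ ⟨h.1.symm, h.2.symm⟩⟩
  loopless := ⟨fun _ h ↦ h.1.ne rfl⟩

-- Away from `v` the two partitions agree, so the inner edge counts differ only by the inner degree
-- of `v` before and after it moves to class `c`.
open Classical in
theorem SimpleGraph.ncard_edgeSet_withinClasses_update {V ι : Type*} [Fintype V] [DecidableEq ι]
    (G : SimpleGraph V) (f : V → ι) (v : V) (c : ι) :
    (G.withinClasses f).edgeSet.ncard + #{w | G.Adj v w ∧ f w = c} =
      (G.withinClasses (Function.update f v c)).edgeSet.ncard + #{w | G.Adj v w ∧ f w = f v} := by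
  have key : (G.withinClasses f).deleteIncidenceSet v =
      (G.withinClasses (Function.update f v c)).deleteIncidenceSet v := by
    ext x y
    simp only [deleteIncidenceSet_adj, withinClasses]
    constructor
    · rintro ⟨h, hx, hy⟩
      simpa [hx, hy] using h
    · rintro ⟨h, hx, hy⟩
      simpa [hx, hy] using h
  have h1 := (G.withinClasses f).ncard_edgeSet_deleteIncidenceSet v
  have h2 := (G.withinClasses (Function.update f v c)).ncard_edgeSet_deleteIncidenceSet v
  have d1 : (G.withinClasses f).degree v = #{w | G.Adj v w ∧ f w = f v} := by
    rw [← card_neighborFinset_eq_degree]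
    congr 1
    ext w
    rw [mem_neighborFinset]
    simp only [withinClasses, mem_filter, mem_univ, true_and]
    rw [eq_comm (a := f v)]
  have d2 : (G.withinClasses (Function.update f v c)).degree v = #{w | G.Adj v w ∧ f w = c} := by
    rw [← card_neighborFinset_eq_degree]
    congr 1
    ext w
    rw [mem_neighborFinset]
    simp only [withinClasses, Function.update_self, mem_filter, mem_univ, true_and]
    refine and_congr_right fun h ↦ ?_
    rw [Function.update_of_ne h.ne', eq_comm]
  rw [key] at h1
  lia

open Classical in
/-- A partition into `j` classes with the fewest edges inside the classes has small degrees inside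
the classes. -/
theorem SimpleGraph.exists_partition_degree_lt {V : Type*} [Fintype V] (G : SimpleGraph V)
    {j d : ℕ} (hj : 0 < j) (h : G.maxDegree < j * d) :
    ∃ f : V → Fin j, ∀ v, #{w | G.Adj v w ∧ f w = f v} < d := by
  have : Nonempty (Fin j) := ⟨⟨0, hj⟩⟩
  obtain ⟨f, hf⟩ := Finite.exists_min fun f : V → Fin j ↦ (G.withinClasses f).edgeSet.ncard
  refine ⟨f, fun v ↦ ?_⟩
  by_contra! hv
  have hsum : G.degree v = ∑ c : Fin j, #{w | G.Adj v w ∧ f w = c} := by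
    rw [← card_neighborFinset_eq_degree,
      card_eq_sum_card_fiberwise (f := f) (t := univ) (fun _ _ ↦ by simp)]
    refine sum_congr rfl fun c _ ↦ ?_
    congr 1
    ext w
    simp
  -- The degree of `v` is below `j * d`, so by averaging some class contains fewer than `d` of its
  -- neighbours. Moving `v` there contradicts minimality.
  have hc : ∃ c : Fin j, #{w | G.Adj v w ∧ f w = c} < d := by
    by_contra! hc
    have := sum_le_sum fun c (_ : c ∈ (univ : Finset (Fin j))) ↦ hc c
    rw [← hsum] at this
    have h' := G.degree_le_maxDegree v
    simp at this
    lia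
  obtain ⟨c, hc⟩ := hc
  have h1 := G.ncard_edgeSet_withinClasses_update f v c
  have h2 := hf (Function.update f v c)
  lia

/-- A centre of a starburst has degree at least `n + k - 1`. -/
theorem starburst_le_degree {k n : ℕ} {V : Type*} {H : SimpleGraph V}
    (φ : SimpleGraph.Copy (starburst k n) H) (i : Fin k) (s : Finset V)
    (hs : ∀ w, H.Adj (φ (Sum.inl i)) w → w ∈ s) : n + k - 1 ≤ #s := by
  classical
  let g : {j : Fin k // j ≠ i} ⊕ Fin n → V :=
    fun a ↦ φ (a.elim (fun j ↦ Sum.inl j.1) fun l ↦ Sum.inr (i, l))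
  have hg : Function.Injective g := by
    intro a b hab
    have := φ.injective hab
    rcases a with ⟨a, ha⟩ | a <;> rcases b with ⟨b, hb⟩ | b <;> simp_all
  have hmem : ∀ a, g a ∈ s := by
    intro a
    refine hs _ (φ.toHom.map_adj ?_)
    rcases a with ⟨a, ha⟩ | a
    · exact ha.symm
    · exact rfl
  have := card_le_card_of_injOn g (s := univ) (t := s) (fun a _ ↦ hmem a) hg.injOn
  have hk := i.pos
  simp [Fintype.card_subtype_compl] at this
  lia

/-- The starburst is connected, so a copy without crossing edges stays in a single class. -/
theorem starburst_copy_withinClasses_eq {k n : ℕ} {V ι : Type*} {G : SimpleGraph V} {f : V → ι}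
    (φ : SimpleGraph.Copy (starburst k n) (G.withinClasses f)) (a b : Fin k ⊕ (Fin k × Fin n)) :
    f (φ a) = f (φ b) := by
  have h1 : ∀ i j : Fin k, f (φ (Sum.inl i)) = f (φ (Sum.inl j)) := by
    intro i j
    by_cases hij : i = j
    · rw [hij]
    · have : (starburst k n).Adj (Sum.inl i) (Sum.inl j) := hij
      exact (φ.toHom.map_adj this).2
  have h2 : ∀ c : Fin k × Fin n, f (φ (Sum.inr c)) = f (φ (Sum.inl c.1)) := by
    intro c
    have : (starburst k n).Adj (Sum.inr c) (Sum.inl c.1) := rfl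
    exact (φ.toHom.map_adj this).2
  have h3 : ∀ a, ∃ i, f (φ a) = f (φ (Sum.inl i)) := by
    rintro (i | c)
    exacts [⟨i, rfl⟩, ⟨c.1, h2 c⟩]
  obtain ⟨i, hi⟩ := h3 a
  obtain ⟨j, hj⟩ := h3 b
  rw [hi, hj, h1 i j]

theorem exists_partition_starburst_free {k n : ℕ} (hk : 0 < k) {V : Type*} [Fintype V] (j : ℕ) :
    ∀ G : SimpleGraph V, G.edgeSet.ncard < j.choose 2 * (n + k - 1) * (k * n + k - 1) →
      ∃ f : V → Fin j, ¬ (starburst k n).IsContained (G.withinClasses f) := by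
  induction j with
  | zero => simp
  | succ j ih =>
    intro G hG
    rcases Nat.eq_zero_or_pos j with rfl | hj
    · simp at hG
    classical
    -- One vertex fewer than the starburst has, so the deleted set can serve as a class of its own.
    obtain ⟨A, G', hA, hadj, hc⟩ := G.exists_greedy_removal (k * n + k - 1)
    have hf : ∃ f : V → Fin j, ¬ (starburst k n).IsContained (G'.withinClasses f) := by
      by_cases hd : G'.maxDegree < j * (n + k - 1)
      · obtain ⟨f, hf⟩ := G'.exists_partition_degree_lt hj hd
        refine ⟨f, fun ⟨φ⟩ ↦ ?_⟩
        have := starburst_le_degree φ ⟨0, hk⟩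
          ({w | G'.Adj (φ (Sum.inl ⟨0, hk⟩)) w ∧ f w = f (φ (Sum.inl ⟨0, hk⟩))} : Finset V)
          (fun w hw ↦ by simpa using ⟨hw.1, hw.2.symm⟩)
        exact absurd (hf _) this.not_gt
      · apply ih
        -- Every deletion cost at least `j * (n + k - 1)` edges; by Pascal's rule this is exactly
        -- the drop in the allowed edge count from `j + 1` to `j`.
        have h1 := Nat.mul_le_mul_left (k * n + k - 1) (not_lt.1 hd)
        have h2 : (j + 1).choose 2 * (n + k - 1) * (k * n + k - 1) =
            j.choose 2 * (n + k - 1) * (k * n + k - 1) +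
              (k * n + k - 1) * (j * (n + k - 1)) := by
          rw [Nat.choose_succ_succ' j 1, Nat.choose_one_right]
          ring
        lia
    obtain ⟨f, hf⟩ := hf
    refine ⟨fun v ↦ if v ∈ A then Fin.last j else (f v).castSucc, fun ⟨φ⟩ ↦ ?_⟩
    have heq := starburst_copy_withinClasses_eq φ
    by_cases hmem : φ (Sum.inl ⟨0, hk⟩) ∈ A
    · have hall : ∀ a, φ a ∈ A := by
        intro a
        by_contra ha
        have := heq a (Sum.inl ⟨0, hk⟩)
        simp only [ha, hmem, if_true, if_false] at this
        exact (Fin.castSucc_lt_last _).ne this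
      have := card_le_card_of_injOn φ (s := univ) (t := A) (fun a _ ↦ hall a) φ.injective.injOn
      simp at this
      lia
    · have hall : ∀ a, φ a ∉ A := by
        intro a ha
        have := heq a (Sum.inl ⟨0, hk⟩)
        simp only [ha, hmem, if_true, if_false] at this
        exact (Fin.castSucc_lt_last _).ne' this
      refine hf ⟨⟨⟨φ, fun {a b} hab ↦ ?_⟩, φ.injective⟩⟩
      have h := φ.toHom.map_adj hab
      refine ⟨(hadj _ _).2 ⟨h.1, hall a, hall b⟩, ?_⟩
      have h2 := heq a b
      simp only [hall, if_false] at h2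
      exact Fin.castSucc_injective _ h2

open Classical in
/-- The two-colouring of `G` whose first colour is given by a symmetric relation `r`. -/
noncomputable def SimpleGraph.labelingOfRel {V : Type*} (G : SimpleGraph V) (r : V → V → Prop)
    (hr : ∀ x y, r x y ↔ r y x) : G.EdgeLabeling (Fin 2) :=
  EdgeLabeling.mk (fun x y _ ↦ if r x y then 0 else 1) fun x y _ ↦ by simp only [hr x y]

theorem SimpleGraph.labelingOfRel_zero_adj {V : Type*} {G : SimpleGraph V} {r : V → V → Prop}
    {hr : ∀ x y, r x y ↔ r y x} {x y : V} (h : ((G.labelingOfRel r hr).labelGraph 0).Adj x y) :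
    G.Adj x y ∧ r x y := by
  rw [EdgeLabeling.labelGraph_adj] at h
  obtain ⟨H, h⟩ := h
  refine ⟨H, ?_⟩
  by_contra hn
  have h' : (@ite _ (r x y) (Classical.propDecidable _) (0 : Fin 2) 1) = 0 := h
  simp [hn] at h'

theorem SimpleGraph.labelingOfRel_one_adj {V : Type*} {G : SimpleGraph V} {r : V → V → Prop}
    {hr : ∀ x y, r x y ↔ r y x} {x y : V} (h : ((G.labelingOfRel r hr).labelGraph 1).Adj x y) :
    G.Adj x y ∧ ¬ r x y := by
  rw [EdgeLabeling.labelGraph_adj] at h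
  obtain ⟨H, h⟩ := h
  refine ⟨H, fun hn ↦ ?_⟩
  have h' : (@ite _ (r x y) (Classical.propDecidable _) (0 : Fin 2) 1) = 1 := h
  simp [hn] at h'

theorem IsRamseyFor.le_ncard_edgeSet {k n : ℕ} (hk : 2 ≤ k) {V : Type*} [Fintype V]
    {G : SimpleGraph V} (hG : IsRamseyFor G (starburst k n)) :
    (k - 1).choose 2 * (n + k - 1) * (k * n + k - 1) ≤ G.edgeSet.ncard := by
  by_contra! hlt
  obtain ⟨f, hf⟩ := exists_partition_starburst_free (by lia : 0 < k) (k - 1) G hlt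
  obtain ⟨c, ⟨φ⟩⟩ := hG (G.labelingOfRel (fun x y ↦ f x = f y) fun x y ↦ eq_comm)
  fin_cases c
  · exact hf ⟨⟨⟨φ, fun {a b} hab ↦ SimpleGraph.labelingOfRel_zero_adj (φ.toHom.map_adj hab)⟩,
      φ.injective⟩⟩
  · have hinj : Function.Injective fun i : Fin k ↦ f (φ (Sum.inl i)) := by
      intro i j hij
      by_contra hne
      have : (starburst k n).Adj (Sum.inl i) (Sum.inl j) := hne
      exact (SimpleGraph.labelingOfRel_one_adj (φ.toHom.map_adj this)).2 hij
    have := Fintype.card_le_of_injective _ hinj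
    simp at this
    lia

/-- Colour the edges inside the set `B` of vertices of degree at least `n + 1` with colour 0. If `B`
has at most `n + 1` vertices, colour 0 has degrees at most `n`; in colour 1 both centres would lie
in `B`, yet be adjacent. Hence `B` is large, and its degrees already give the bound. -/
theorem IsRamseyFor.le_two_mul_ncard_edgeSet {n : ℕ} {V : Type*} [Fintype V]
    {G : SimpleGraph V} (hG : IsRamseyFor G (starburst 2 n)) :
    (n + 2) * (n + 1) ≤ 2 * G.edgeSet.ncard := by
  classical
  let B : Finset V := {v | n + 1 ≤ G.degree v}
  have hB : n + 2 ≤ #B := by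
    by_contra! hlt
    obtain ⟨c, ⟨φ⟩⟩ := hG (G.labelingOfRel (fun x y ↦ x ∈ B ∧ y ∈ B) fun x y ↦ and_comm)
    fin_cases c
    · have h0 : φ (Sum.inl 0) ∈ B := by
        have : (starburst 2 n).Adj (Sum.inl 0) (Sum.inl 1) := by
          change (0 : Fin 2) ≠ 1
          decide
        exact (SimpleGraph.labelingOfRel_zero_adj (φ.toHom.map_adj this)).2.1
      have := starburst_le_degree φ 0 (B.erase (φ (Sum.inl 0))) fun w hw ↦
        mem_erase.2 ⟨hw.ne', (SimpleGraph.labelingOfRel_zero_adj hw).2.2⟩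
      rw [card_erase_of_mem h0] at this
      lia
    · have hmem : ∀ i, φ (Sum.inl i) ∈ B := by
        intro i
        have := starburst_le_degree φ i (G.neighborFinset (φ (Sum.inl i))) fun w hw ↦ by
          simpa using (SimpleGraph.labelingOfRel_one_adj hw).1
        simpa [B] using this
      have : (starburst 2 n).Adj (Sum.inl 0) (Sum.inl 1) := by
        change (0 : Fin 2) ≠ 1
        decide
      exact (SimpleGraph.labelingOfRel_one_adj (φ.toHom.map_adj this)).2 ⟨hmem 0, hmem 1⟩
  rw [G.ncard_edgeSet, ← G.sum_degrees_eq_twice_card_edges]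
  calc (n + 2) * (n + 1) ≤ #B * (n + 1) := by gcongr
    _ = ∑ v ∈ B, (n + 1) := by simp
    _ ≤ ∑ v ∈ B, G.degree v := sum_le_sum fun v hv ↦ by simpa [B] using hv
    _ ≤ ∑ v, G.degree v := sum_le_sum_of_subset (subset_univ _)

end LowerBound

/-! ### Monotonicity, starbursts from Hall's theorem, and Ramsey's theorem. -/

section RamseyBasics

theorem IsRamseyFor.of_iso {V V' W : Type*} {G : SimpleGraph V} {G' : SimpleGraph V'}
    {H : SimpleGraph W} (h : IsRamseyFor G H) (e : G ≃g G') : IsRamseyFor G' H := by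
  intro χ
  obtain ⟨c, ⟨φ⟩⟩ := h (χ.pullback e.toHom)
  refine ⟨c, ⟨⟨⟨fun a ↦ e (φ a), fun {a b} hab ↦ ?_⟩, e.injective.comp φ.injective⟩⟩⟩
  have h1 := φ.toHom.map_adj hab
  rw [SimpleGraph.EdgeLabeling.labelGraph_adj] at h1 ⊢
  obtain ⟨H1, h1⟩ := h1
  exact ⟨e.map_adj_iff.2 H1, h1⟩

theorem IsRamseyFor.mono {V W W' : Type*} {G : SimpleGraph V} {H : SimpleGraph W}
    {H' : SimpleGraph W'} (h : IsRamseyFor G H') (hH : H.IsContained H') : IsRamseyFor G H :=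
  fun χ ↦ (h χ).imp fun _ h' ↦ hH.trans h'

theorem sizeRamsey_le {V W : Type*} [Fintype V] {G : SimpleGraph V} {H : SimpleGraph W}
    (h : IsRamseyFor G H) : sizeRamsey H ≤ G.edgeSet.ncard := by
  let e := SimpleGraph.Iso.map (Fintype.equivFin V) G
  refine Nat.sInf_le ⟨_, _, h.of_iso e, ?_⟩
  rw [← Nat.card_coe_set_eq, ← Nat.card_coe_set_eq]
  exact (Nat.card_congr e.mapEdgeSet).symm

theorem exists_isRamseyFor_ncard_eq_sizeRamsey {V W : Type*} [Fintype V] {G : SimpleGraph V}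
    {H : SimpleGraph W} (h : IsRamseyFor G H) :
    ∃ (N : ℕ) (G' : SimpleGraph (Fin N)), IsRamseyFor G' H ∧ G'.edgeSet.ncard = sizeRamsey H := by
  let e := SimpleGraph.Iso.map (Fintype.equivFin V) G
  exact Nat.sInf_mem (s := {m : ℕ | ∃ (N : ℕ) (G : SimpleGraph (Fin N)),
    IsRamseyFor G H ∧ G.edgeSet.ncard = m}) ⟨_, _, _, h.of_iso e, rfl⟩

theorem starburst_isContained_starburst {k k' n n' : ℕ} (hk : k ≤ k') (hn : n ≤ n') :
    (starburst k n).IsContained (starburst k' n') := by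
  refine ⟨⟨⟨Sum.map (Fin.castLE hk) (Prod.map (Fin.castLE hk) (Fin.castLE hn)), ?_⟩, ?_⟩⟩
  · rintro (i | ⟨i, l⟩) (j | ⟨j, m⟩) h
    · exact fun h' ↦ h (Fin.castLE_injective hk h')
    · exact congrArg (Fin.castLE hk) h
    · exact congrArg (Fin.castLE hk) h
    · exact h
  · exact Sum.map_injective.2 ⟨Fin.castLE_injective hk,
      (Fin.castLE_injective hk).prodMap (Fin.castLE_injective hn)⟩

/-- A clique, together with sets of neighbours that satisfy Hall's condition, gives a starburst. -/
theorem starburst_isContained_of_hall {k n : ℕ} {V : Type*} [DecidableEq V] {H : SimpleGraph V}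
    (c : Fin k → V) (hc : ∀ i j, i ≠ j → H.Adj (c i) (c j)) (L : Fin k → Finset V)
    (hL : ∀ i, ∀ w ∈ L i, H.Adj (c i) w) (hcL : ∀ i j, c j ∉ L i)
    (hall : ∀ s : Finset (Fin k), #s * n ≤ #(s.biUnion L)) :
    (starburst k n).IsContained H := by
  have h : ∀ s : Finset (Fin k × Fin n), #s ≤ #(s.biUnion fun a ↦ L a.1) := by
    intro s
    have h1 : s ⊆ s.image Prod.fst ×ˢ univ := by
      intro a ha
      simp only [mem_product, mem_image, mem_univ, and_true]
      exact ⟨a, ha, rfl⟩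
    calc #s ≤ #(s.image Prod.fst) * n := by simpa using card_le_card h1
      _ ≤ #((s.image Prod.fst).biUnion L) := hall _
      _ = #(s.biUnion fun a ↦ L a.1) := by rw [image_biUnion]
  obtain ⟨f, hf, hfL⟩ :=
    (all_card_le_biUnion_card_iff_exists_injective fun a : Fin k × Fin n ↦ L a.1).1 h
  refine ⟨⟨⟨Sum.elim c f, ?_⟩, ?_⟩⟩
  · rintro (i | a) (j | b) h
    · exact hc i j h
    · obtain rfl : i = b.1 := h
      exact hL _ _ (hfL b)
    · obtain rfl : a.1 = j := h
      exact (hL _ _ (hfL a)).symm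
    · exact h.elim
  · refine Function.Injective.sumElim ?_ hf fun i a h ↦ hcL a.1 i (h ▸ hfL a)
    intro i j hij
    by_contra hne
    exact (hc i j hne).ne hij

/-- After removing the `k` centres, each neighbourhood alone still has room for all `kn` leaves, so
Hall's condition is immediate even if the neighbourhoods coincide. -/
theorem starburst_isContained_of_card_le {k n : ℕ} {V : Type*} [DecidableEq V]
    {H : SimpleGraph V} (c : Fin k → V) (hc : ∀ i j, i ≠ j → H.Adj (c i) (c j))
    (L : Fin k → Finset V) (hL : ∀ i, ∀ w ∈ L i, H.Adj (c i) w)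
    (hcard : ∀ i, k * n + k ≤ #(L i)) : (starburst k n).IsContained H := by
  refine starburst_isContained_of_hall c hc (fun i ↦ L i \ univ.image c)
    (fun i w hw ↦ hL i w (mem_sdiff.1 hw).1) (fun i j h ↦ (mem_sdiff.1 h).2 (by simp)) fun s ↦ ?_
  rcases s.eq_empty_or_nonempty with rfl | ⟨i, hi⟩
  · simp
  · have h1 : #(L i \ univ.image c) ≤ #(s.biUnion fun i ↦ L i \ univ.image c) :=
      card_le_card fun w hw ↦ mem_biUnion.2 ⟨i, hi, hw⟩
    have h2 := le_card_sdiff (univ.image c) (L i)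
    have h3 : #(univ.image c) ≤ k := card_image_le.trans (by simp)
    have h4 : #s * n ≤ k * n := Nat.mul_le_mul_right _ ((card_le_univ s).trans (by simp))
    have := hcard i
    lia

theorem starburst_isContained_of_pairwiseDisjoint {k n : ℕ} {V : Type*} [DecidableEq V]
    {H : SimpleGraph V} (c : Fin k → V) (hc : ∀ i j, i ≠ j → H.Adj (c i) (c j))
    (L : Fin k → Finset V) (hL : ∀ i, ∀ w ∈ L i, H.Adj (c i) w)
    (hdisj : ∀ i j, i ≠ j → Disjoint (L i) (L j)) (hcard : ∀ i, n + k ≤ #(L i)) :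
    (starburst k n).IsContained H := by
  refine starburst_isContained_of_hall c hc (fun i ↦ L i \ univ.image c)
    (fun i w hw ↦ hL i w (mem_sdiff.1 hw).1) (fun i j h ↦ (mem_sdiff.1 h).2 (by simp)) fun s ↦ ?_
  rw [card_biUnion fun i _ j _ hij ↦
    (hdisj i j hij).mono sdiff_subset sdiff_subset, ← smul_eq_mul]
  refine card_nsmul_le_sum _ _ _ fun i _ ↦ ?_
  have h2 := le_card_sdiff (univ.image c) (L i)
  have h3 : #(univ.image c) ≤ k := card_image_le.trans (by simp)
  have := hcard i
  lia

/-- **Ramsey's theorem** for two graphs that cover all pairs of a finite set. -/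
theorem exists_isNClique_of_two_pow_le_card {V : Type*} [DecidableEq V] (A B : SimpleGraph V)
    (m : ℕ) : ∀ a b : ℕ, a + b = m → ∀ s : Finset V, 2 ^ m ≤ #s →
      (∀ x ∈ s, ∀ y ∈ s, x ≠ y → A.Adj x y ∨ B.Adj x y) →
      (∃ t ⊆ s, A.IsNClique a t) ∨ ∃ t ⊆ s, B.IsNClique b t := by
  classical
  induction m with
  | zero =>
    intro a b hab s _ _
    obtain rfl : a = 0 := by lia
    exact .inl ⟨∅, empty_subset _, by simp⟩
  | succ m ih =>
    intro a b hab s hs hcov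
    rcases Nat.eq_zero_or_pos a with rfl | ha
    · exact .inl ⟨∅, empty_subset _, by simp⟩
    rcases Nat.eq_zero_or_pos b with rfl | hb
    · exact .inr ⟨∅, empty_subset _, by simp⟩
    obtain ⟨v, hv⟩ : s.Nonempty := card_pos.1 (lt_of_lt_of_le (by positivity) hs)
    have hsplit : #{w ∈ s.erase v | A.Adj v w} + #{w ∈ s.erase v | ¬ A.Adj v w} = #s - 1 := by
      rw [card_filter_add_card_filter_not, card_erase_of_mem hv]
    rw [pow_succ] at hs
    have hbig : 2 ^ m ≤ #{w ∈ s.erase v | A.Adj v w} ∨ 2 ^ m ≤ #{w ∈ s.erase v | ¬ A.Adj v w} := by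
      lia
    have hAB : ∀ w ∈ ({w ∈ s.erase v | ¬ A.Adj v w} : Finset V), B.Adj v w := by
      intro w hw
      simp only [mem_filter, mem_erase] at hw
      exact (hcov v hv w hw.1.2 hw.1.1.symm).resolve_left hw.2
    rcases hbig with hbig | hbig
    · have hsub : ({w ∈ s.erase v | A.Adj v w} : Finset V) ⊆ s :=
        (filter_subset _ _).trans (erase_subset _ _)
      rcases ih (a - 1) b (by lia) _ hbig
        (fun x hx y hy ↦ hcov x (hsub hx) y (hsub hy)) with ⟨t, ht, hc⟩ | ⟨t, ht, hc⟩
      · refine .inl ⟨insert v t, insert_subset hv (ht.trans hsub), ?_⟩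
        have := hc.insert (a := v) fun w hw ↦ (mem_filter.1 (ht hw)).2
        rwa [Nat.sub_add_cancel ha] at this
      · exact .inr ⟨t, ht.trans hsub, hc⟩
    · have hsub : ({w ∈ s.erase v | ¬ A.Adj v w} : Finset V) ⊆ s :=
        (filter_subset _ _).trans (erase_subset _ _)
      rcases ih a (b - 1) (by lia) _ hbig
        (fun x hx y hy ↦ hcov x (hsub hx) y (hsub hy)) with ⟨t, ht, hc⟩ | ⟨t, ht, hc⟩
      · exact .inl ⟨t, ht.trans hsub, hc⟩
      · refine .inr ⟨insert v t, insert_subset hv (ht.trans hsub), ?_⟩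
        have := hc.insert (a := v) fun w hw ↦ hAB w (ht hw)
        rwa [Nat.sub_add_cancel hb] at this

end RamseyBasics

/-! ### Pair counts, transversal cliques and Turán's theorem. -/

section Regularity

open Classical in
/-- The neighbours of `x` in the finite set `Y`. -/
noncomputable def SimpleGraph.nbrs {V : Type*} (G : SimpleGraph V) (Y : Finset V) (x : V) :
    Finset V := {y ∈ Y | G.Adj x y}

@[simp]
theorem SimpleGraph.mem_nbrs {V : Type*} {G : SimpleGraph V} {Y : Finset V} {x y : V} :
    y ∈ G.nbrs Y x ↔ y ∈ Y ∧ G.Adj x y := by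
  simp [nbrs]

theorem SimpleGraph.nbrs_subset {V : Type*} {G : SimpleGraph V} {Y : Finset V} {x : V} :
    G.nbrs Y x ⊆ Y :=
  fun _ h ↦ (mem_nbrs.1 h).1

/-- The number of ordered pairs in `A × B` that are adjacent in `G`. -/
noncomputable def SimpleGraph.pairCount {V : Type*} (G : SimpleGraph V) (A B : Finset V) : ℝ :=
  ∑ a ∈ A, (#(G.nbrs B a) : ℝ)

theorem SimpleGraph.pairCount_mono {V : Type*} {G G' : SimpleGraph V} (h : G ≤ G')
    {A A' B B' : Finset V} (hA : A ⊆ A') (hB : B ⊆ B') : G.pairCount A B ≤ G'.pairCount A' B' := by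
  classical
  unfold pairCount
  refine (sum_le_sum fun a _ ↦ ?_).trans
    (sum_le_sum_of_subset_of_nonneg hA fun _ _ _ ↦ Nat.cast_nonneg _)
  exact_mod_cast card_le_card fun b hb ↦ by
    rw [mem_nbrs] at hb ⊢
    exact ⟨hB hb.1, h hb.2⟩

theorem SimpleGraph.edgeDensity_mul_card {V : Type*} (G : SimpleGraph V) [DecidableRel G.Adj]
    (A B : Finset V) : (G.edgeDensity A B : ℝ) * (#A * #B) = G.pairCount A B := by
  classical
  have h : (#(G.interedges A B) : ℝ) = G.pairCount A B := by
    unfold pairCount interedges Rel.interedges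
    rw [card_filter, sum_product]
    push_cast
    refine sum_congr rfl fun a _ ↦ ?_
    rw [nbrs, card_filter]
    push_cast
    exact sum_congr rfl fun b _ ↦ by congr
  rcases A.eq_empty_or_nonempty with rfl | hA
  · simp [pairCount, nbrs]
  rcases B.eq_empty_or_nonempty with rfl | hB
  · simp [pairCount, nbrs]
  have h1 : (0 : ℝ) < #A := by exact_mod_cast hA.card_pos
  have h2 : (0 : ℝ) < #B := by exact_mod_cast hB.card_pos
  rw [← h, edgeDensity_def]
  push_cast
  field_simp

theorem SimpleGraph.pairCount_biUnion_right {V ι : Type*} [DecidableEq V] (G : SimpleGraph V)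
    (A : Finset V) (s : Finset ι) (f : ι → Finset V)
    (hf : (s : Set ι).PairwiseDisjoint f) :
    G.pairCount A (s.biUnion f) = ∑ i ∈ s, G.pairCount A (f i) := by
  classical
  unfold pairCount
  rw [sum_comm]
  refine sum_congr rfl fun a _ ↦ ?_
  rw [nbrs, filter_biUnion, card_biUnion fun i hi j hj hij ↦
    (hf hi hj hij).mono (filter_subset _ _) (filter_subset _ _)]
  push_cast
  exact sum_congr rfl fun i _ ↦ by congr

/-- The greedy counting-lemma argument: fewer than `θ |A a|` vertices of `A a` have too few
neighbours in a given other part, so some vertex is good for all of them. Passing to its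
neighbourhoods shrinks each part by a factor at least `d`, compensated by replacing `θ` with `θ /
d`. The parts need not be disjoint. -/
theorem SimpleGraph.exists_transversal_clique {V ι : Type*} [Nonempty V]
    [DecidableEq ι] (G : SimpleGraph V)
    {d : ℝ} (hd : 0 < d) (hd1 : d ≤ 1) (s : Finset ι) :
    ∀ (A : ι → Finset V) (θ : ℝ), 0 < θ → #s * θ ≤ d ^ #s → (∀ i ∈ s, (A i).Nonempty) →
      (∀ i ∈ s, ∀ j ∈ s, i ≠ j → ∀ A' ⊆ A i, ∀ B' ⊆ A j, θ * #(A i) ≤ #A' → θ * #(A j) ≤ #B' →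
        d * (#A' * #B') ≤ G.pairCount A' B') →
      ∃ v : ι → V, (∀ i ∈ s, v i ∈ A i) ∧ ∀ i ∈ s, ∀ j ∈ s, i ≠ j → G.Adj (v i) (v j) := by
  classical
  induction s using Finset.induction_on with
  | empty =>
    intro A θ _ _ _ _
    exact ⟨fun _ ↦ Classical.arbitrary V, by simp, by simp⟩
  | insert a s has ih =>
    intro A θ hθ hθd hne hreg
    rw [card_insert_of_notMem has] at hθd
    push_cast at hθd
    have hpow : d ^ (#s + 1) ≤ 1 := pow_le_one₀ hd.le hd1
    have hsθ : (#s : ℝ) * θ ≤ 1 := by nlinarith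
    have hθ1 : θ ≤ 1 := by nlinarith [(Nat.cast_nonneg #s : (0 : ℝ) ≤ #s)]
    have hApos : (0 : ℝ) < #(A a) := by exact_mod_cast (hne a (mem_insert_self _ _)).card_pos
    let bad : ι → Finset V := fun i ↦ {v ∈ A a | (#(G.nbrs (A i) v) : ℝ) < d * #(A i)}
    have hbad : ∀ i ∈ s, (#(bad i) : ℝ) < θ * #(A a) := by
      intro i hi
      by_contra! hge
      have hai : a ≠ i := fun h ↦ has (h ▸ hi)
      have hnb : (bad i).Nonempty := by
        rw [← card_pos]
        exact Nat.cast_pos.1 (lt_of_lt_of_le (by positivity : (0 : ℝ) < θ * #(A a)) hge)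
      have h1 := hreg a (mem_insert_self _ _) i (mem_insert_of_mem hi) hai (bad i)
        (filter_subset _ _) (A i) subset_rfl hge
        (mul_le_of_le_one_left (Nat.cast_nonneg _) hθ1)
      have h2 : G.pairCount (bad i) (A i) < ∑ _v ∈ bad i, d * #(A i) :=
        sum_lt_sum_of_nonempty hnb fun v hv ↦ (mem_filter.1 hv).2
      rw [sum_const, nsmul_eq_mul] at h2
      nlinarith
    have hex : ∃ v ∈ A a, v ∉ s.biUnion bad := by
      by_contra! hall
      have h1 : #(A a) ≤ ∑ i ∈ s, #(bad i) := (card_le_card hall).trans card_biUnion_le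
      have h1' : (#(A a) : ℝ) ≤ ∑ i ∈ s, (#(bad i) : ℝ) := by exact_mod_cast h1
      rcases s.eq_empty_or_nonempty with rfl | hs
      · simp at h1'
        simp [h1'] at hApos
      · have h2 := sum_lt_sum_of_nonempty hs hbad
        rw [sum_const, nsmul_eq_mul] at h2
        nlinarith
    obtain ⟨v, hvA, hv⟩ := hex
    have hvdeg : ∀ i ∈ s, d * #(A i) ≤ #(G.nbrs (A i) v) := by
      intro i hi
      by_contra! hlt
      exact hv (mem_biUnion.2 ⟨i, hi, mem_filter.2 ⟨hvA, hlt⟩⟩)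
    obtain ⟨u, hu, huadj⟩ := ih (fun i ↦ G.nbrs (A i) v) (θ / d) (by positivity)
      (by
        rw [← mul_div_assoc, div_le_iff₀ hd, ← pow_succ]
        nlinarith)
      (fun i hi ↦ by
        rw [← card_pos]
        have h1 : (0 : ℝ) < #(A i) := by exact_mod_cast (hne i (mem_insert_of_mem hi)).card_pos
        exact Nat.cast_pos.1 (lt_of_lt_of_le (by positivity : (0 : ℝ) < d * #(A i)) (hvdeg i hi)))
      (fun i hi j hj hij A' hA' B' hB' h1 h2 ↦ by
        refine hreg i (mem_insert_of_mem hi) j (mem_insert_of_mem hj) hij A'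
          (hA'.trans nbrs_subset) B' (hB'.trans nbrs_subset) ?_ ?_
        · refine le_trans ?_ h1
          rw [div_mul_eq_mul_div, le_div_iff₀ hd]
          nlinarith [hvdeg i hi]
        · refine le_trans ?_ h2
          rw [div_mul_eq_mul_div, le_div_iff₀ hd]
          nlinarith [hvdeg j hj])
    have hus : ∀ i ∈ s, i ≠ a := fun i hi h ↦ has (h ▸ hi)
    refine ⟨Function.update u a v, fun i hi ↦ ?_, fun i hi j hj hij ↦ ?_⟩
    · rcases mem_insert.1 hi with rfl | hi
      · simpa using hvA
      · rw [Function.update_of_ne (hus i hi)]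
        exact (mem_nbrs.1 (hu i hi)).1
    · rcases mem_insert.1 hi with hi | hi <;> rcases mem_insert.1 hj with hj | hj
      · exact (hij (hi.trans hj.symm)).elim
      · rw [hi, Function.update_self, Function.update_of_ne (hus j hj)]
        exact (mem_nbrs.1 (hu j hj)).2
      · rw [hj, Function.update_self, Function.update_of_ne (hus i hi)]
        exact (mem_nbrs.1 (hu i hi)).2.symm
      · rw [Function.update_of_ne (hus i hi), Function.update_of_ne (hus j hj)]
        exact huadj i hi j hj hij

open Classical in
/-- Turán's theorem in terms of the number of non-adjacent ordered pairs. -/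
theorem SimpleGraph.CliqueFree.sq_card_le {W : Type*} [Fintype W] {H : SimpleGraph W} {r : ℕ}
    (hr : 0 < r) (h : H.CliqueFree (r + 1)) :
    Fintype.card W ^ 2 ≤ r * ∑ w : W, #{u | ¬ H.Adj w u} := by
  have h1 : 2 * r * #H.edgeFinset ≤ (r - 1) * Fintype.card W ^ 2 := by
    refine le_trans ?_ (mul_card_edgeFinset_turanGraph_le (n := Fintype.card W) (r := r))
    obtain ⟨H', _, maxH⟩ := exists_isTuranMaximal (V := W) hr
    have h2 := maxH.2 h
    rw [((isTuranMaximal_iff_nonempty_iso_turanGraph hr).mp maxH).some.card_edgeFinset_eq] at h2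
    exact Nat.mul_le_mul_left _ h2
  have h2 : ∑ w : W, #{u | ¬ H.Adj w u} + 2 * #H.edgeFinset = Fintype.card W ^ 2 := by
    rw [← H.sum_degrees_eq_twice_card_edges, ← sum_add_distrib]
    have : ∀ w ∈ (univ : Finset W), #{u | ¬ H.Adj w u} + H.degree w = Fintype.card W := by
      intro w _
      rw [← card_neighborFinset_eq_degree, neighborFinset_eq_filter, add_comm,
        card_filter_add_card_filter_not, card_univ]
    rw [sum_congr rfl this]
    simp [sq]
  obtain ⟨r, rfl⟩ : ∃ r', r = r' + 1 := ⟨r - 1, by lia⟩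
  simp only [Nat.add_sub_cancel] at h1
  nlinarith

end Regularity

/-! ### A sparse pair in a `K_k`-free graph. -/

section SparsePair

-- The reduced graph of dense regular pairs is `K_k`-free, so Turán's theorem forces at least `M² /
-- (k - 1)` non-adjacent ordered pairs among the `M` parts. The diagonal and the irregular pairs
-- each contribute at most `M² / (4k)`; were every part to have fewer than `M / (2k)` sparse
-- partners, the total would be at most `M² / k`.
open Classical in
theorem exists_part_many_sparse {V : Type*} [Fintype V] [Nonempty V] {R : SimpleGraph V} {k : ℕ}
    (hk : 2 ≤ k) (hR : R.CliqueFree k) {d ε : ℝ} (hd : 0 < d) (hd1 : d ≤ 1) (hε : 0 < ε)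
    (hεd : ε ≤ d / 2) (hεk : k * ε ≤ (d / 2) ^ k) (hε4 : ε ≤ 1 / (4 * k))
    (P : Finpartition (univ : Finset V)) (hP : P.IsUniform R ε) (hM : 4 * k ≤ #P.parts) :
    ∃ c ∈ P.parts, #P.parts ≤ 2 * k * #{c' ∈ P.parts | c ≠ c' ∧ (R.edgeDensity c c' : ℝ) < d} := by
  by_contra! hsparse
  let H : SimpleGraph P.parts :=
    { Adj := fun c c' ↦ c ≠ c' ∧ R.IsUniform ε c.1 c'.1 ∧ d ≤ (R.edgeDensity c.1 c'.1 : ℝ)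
      symm := ⟨fun c c' h ↦ ⟨h.1.symm, h.2.1.symm, by rw [R.edgeDensity_comm]; exact h.2.2⟩⟩
      loopless := ⟨fun c h ↦ h.1 rfl⟩ }
  have hfree : H.CliqueFree k := by
    intro t ht
    obtain ⟨v, -, hv⟩ := R.exists_transversal_clique (half_pos hd) (by linarith) t
      (fun c ↦ c.1) ε hε (by rw [ht.card_eq]; exact hεk)
      (fun c _ ↦ P.nonempty_of_mem_parts c.2) (fun i hi j hj hij A' hA' B' hB' h1 h2 ↦ by
        have hadj : H.Adj i j := ht.isClique hi hj hij
        have h3 := abs_lt.1 (hadj.2.1 hA' hB' (by rwa [mul_comm]) (by rwa [mul_comm]))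
        rw [← R.edgeDensity_mul_card]
        gcongr
        linarith [h3.1, hadj.2.2])
    refine hR (t.image v) ⟨?_, ?_⟩
    · intro x hx y hy hxy
      simp only [coe_image, Set.mem_image, mem_coe] at hx hy
      obtain ⟨i, hi, rfl⟩ := hx
      obtain ⟨j, hj, rfl⟩ := hy
      exact hv i hi j hj fun h ↦ hxy (h ▸ rfl)
    · rw [card_image_of_injOn, ht.card_eq]
      intro i hi j hj hij
      by_contra hne
      exact (hv i hi j hj hne).ne hij
  obtain ⟨r, rfl⟩ : ∃ r, k = r + 1 := ⟨k - 1, by lia⟩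
  have hT := hfree.sq_card_le (by lia)
  rw [Fintype.card_coe] at hT
  set M := #P.parts with hMdef
  let sp : Finset V → ℕ := fun c ↦ #{c' ∈ P.parts | c ≠ c' ∧ (R.edgeDensity c c' : ℝ) < d}
  let nu : Finset V → ℕ := fun c ↦ #{c' ∈ P.parts | c ≠ c' ∧ ¬ R.IsUniform ε c c'}
  have hsum : ∑ w : P.parts, #{u | ¬ H.Adj w u} ≤ ∑ c ∈ P.parts, (1 + sp c + nu c) := by
    rw [← sum_coe_sort P.parts]
    refine sum_le_sum fun w _ ↦ ?_
    have h1 : #{u | ¬ H.Adj w u} = #(({u | ¬ H.Adj w u} : Finset P.parts).image Subtype.val) :=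
      (card_image_of_injective _ Subtype.val_injective).symm
    rw [h1]
    refine (card_le_card (t := {w.1} ∪ {c' ∈ P.parts | w.1 ≠ c' ∧ (R.edgeDensity w.1 c' : ℝ) < d} ∪
      {c' ∈ P.parts | w.1 ≠ c' ∧ ¬ R.IsUniform ε w.1 c'}) ?_).trans
      ((card_union_le _ _).trans (Nat.add_le_add_right (card_union_le _ _) _))
    intro c hc
    simp only [mem_image, mem_filter, mem_univ, true_and] at hc
    obtain ⟨u, hu, rfl⟩ := hc
    simp only [mem_union, mem_singleton, mem_filter, u.2, true_and]
    by_contra hn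
    push Not at hn
    refine hu ⟨fun h ↦ hn.1.1 (h ▸ rfl), hn.2 ?_, hn.1.2 ?_⟩ <;> exact fun h ↦ hn.1.1 h.symm
  have hnu : ∑ c ∈ P.parts, nu c = #(P.nonUniforms R ε) := by
    rw [card_eq_sum_card_fiberwise (f := Prod.fst) (t := P.parts)]
    · refine sum_congr rfl fun c hc ↦ ?_
      refine card_bij (fun c' _ ↦ (c, c')) ?_ ?_ ?_
      · intro c' hc'
        simp only [mem_filter] at hc'
        simp [hc, hc'.1, hc'.2.1, hc'.2.2]
      · intro a _ b _ h
        exact (Prod.ext_iff.1 h).2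
      · rintro ⟨a, b⟩ hab
        simp only [mem_filter, Finpartition.mk_mem_nonUniforms] at hab
        obtain ⟨⟨ha, hb, hne, hu⟩, rfl⟩ := hab
        exact ⟨b, by simp [hb, hne, hu], rfl⟩
    · rintro ⟨a, b⟩ hab
      exact ((Finpartition.mk_mem_nonUniforms _ _).1 hab).1
  have hsp : 2 * (r + 1) * ∑ c ∈ P.parts, sp c ≤ M * M := by
    rw [mul_sum, hMdef, ← smul_eq_mul (#P.parts)]
    exact sum_le_card_nsmul _ _ _ fun c hc ↦ (hsparse c hc).le
  have hnu2 : (#(P.nonUniforms R ε) : ℝ) ≤ M * M * (1 / (4 * (r + 1))) := by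
    refine hP.trans ?_
    have h1 : ((M * (M - 1) : ℕ) : ℝ) ≤ M * M := by
      exact_mod_cast Nat.mul_le_mul_left M (Nat.sub_le M 1)
    push_cast at hε4
    exact mul_le_mul h1 hε4 hε.le (by positivity)
  rw [sum_add_distrib, sum_add_distrib, hnu] at hsum
  simp only [sum_const, smul_eq_mul, mul_one] at hsum
  rw [← hMdef] at hsum
  have hT' : (M : ℝ) ^ 2 ≤ r * (M + (∑ c ∈ P.parts, sp c : ℕ) + #(P.nonUniforms R ε)) := by
    have h1 : M ^ 2 ≤ r * (M + ∑ c ∈ P.parts, sp c + #(P.nonUniforms R ε)) :=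
      hT.trans (Nat.mul_le_mul_left _ (le_trans (sum_congr rfl fun w _ ↦ by congr).le hsum))
    exact_mod_cast h1
  have hsp' : 2 * ((r : ℝ) + 1) * (∑ c ∈ P.parts, sp c : ℕ) ≤ M * M := by exact_mod_cast hsp
  have hM' : 4 * ((r : ℝ) + 1) ≤ M := by exact_mod_cast hM
  have hr : (1 : ℝ) ≤ r := by exact_mod_cast (by lia : 1 ≤ r)
  have hMpos : (0 : ℝ) < M := by linarith
  have hnu3 : 4 * ((r : ℝ) + 1) * #(P.nonUniforms R ε) ≤ M * M := by
    have h0 : (0 : ℝ) < 4 * (r + 1) := by positivity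
    rw [mul_one_div, le_div_iff₀ h0] at hnu2
    linarith
  set s : ℝ := ((∑ c ∈ P.parts, sp c : ℕ) : ℝ)
  set u : ℝ := (#(P.nonUniforms R ε) : ℝ)
  have h5 : ((r : ℝ) + 1) * (M + s + u) ≤ M * M := by nlinarith
  have hs0 : 0 ≤ s := Nat.cast_nonneg _
  have hu0 : 0 ≤ u := Nat.cast_nonneg _
  nlinarith

theorem exists_sparse_pair {k : ℕ} (hk : 2 ≤ k) {d : ℝ} (hd : 0 < d) (hd1 : d ≤ 1) :
    ∃ M : ℕ, 0 < M ∧ ∀ (V : Type) [Fintype V] (R : SimpleGraph V), M ≤ Fintype.card V →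
      R.CliqueFree k → ∃ c Y : Finset V, Fintype.card V ≤ M * #c ∧
        Fintype.card V ≤ 4 * k * #Y ∧ R.pairCount c Y ≤ d * (#c * #Y) := by
  classical
  have hkpos : (0 : ℝ) < k := by exact_mod_cast (by lia : 0 < k)
  have hk1 : (1 : ℝ) ≤ k := by exact_mod_cast (by lia : 1 ≤ k)
  obtain ⟨ε, hε, hεd, hεk, hε4⟩ : ∃ ε : ℝ, 0 < ε ∧ ε ≤ d / 2 ∧ k * ε ≤ (d / 2) ^ k ∧
      ε ≤ 1 / (4 * k) := by
    refine ⟨min (d / 2) (min ((d / 2) ^ k / k) (1 / (4 * k))), by positivity, min_le_left _ _, ?_,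
      (min_le_right _ _).trans (min_le_right _ _)⟩
    rw [mul_comm, ← le_div_iff₀ hkpos]
    exact (min_le_right _ _).trans (min_le_left _ _)
  refine ⟨2 * SzemerediRegularity.bound ε (4 * k),
    Nat.mul_pos two_pos (SzemerediRegularity.bound_pos ..), fun V _ R hV hR ↦ ?_⟩
  have hb : 4 * k ≤ SzemerediRegularity.bound ε (4 * k) := SzemerediRegularity.le_bound ..
  have : Nonempty V := Fintype.card_pos_iff.1 (by lia)
  obtain ⟨P, hPe, hl, hu, hPu⟩ := szemeredi_regularity R hε (by lia : 4 * k ≤ Fintype.card V)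
  obtain ⟨c, hc, hcs⟩ := exists_part_many_sparse hk hR hd hd1 hε hεd hεk hε4 P hPu hl
  -- Rounding down the average part size loses at most a factor of two, which accounts for the `2`
  -- in `M` and for `4 * k` rather than `2 * k`.
  have hpart : ∀ c ∈ P.parts, Fintype.card V ≤ 2 * #P.parts * #c := by
    intro c hc
    have h1 := hPe.average_le_card_part hc
    rw [card_univ] at h1
    have h2 : 0 < #P.parts := by lia
    have h3 := Nat.lt_mul_div_succ (Fintype.card V) h2
    have h4 : 1 ≤ Fintype.card V / #P.parts := (Nat.one_le_div_iff h2).2 (by lia)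
    nlinarith
  set S : Finset (Finset V) := {c' ∈ P.parts | c ≠ c' ∧ (R.edgeDensity c c' : ℝ) < d} with hS
  have hSP : ∀ c' ∈ S, c' ∈ P.parts := fun c' hc' ↦ (mem_filter.1 hc').1
  have hdisj : (S : Set (Finset V)).PairwiseDisjoint id :=
    P.disjoint.subset fun c' hc' ↦ hSP c' hc'
  refine ⟨c, S.biUnion id, (hpart c hc).trans (by gcongr), ?_, ?_⟩
  · rw [card_biUnion hdisj]
    have h1 : #S * Fintype.card V ≤ 2 * #P.parts * ∑ c' ∈ S, #c' := by
      rw [mul_sum, ← smul_eq_mul (#S)]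
      exact card_nsmul_le_sum _ _ _ fun c' hc' ↦ hpart c' (hSP c' hc')
    have h2 : 0 < #P.parts := by lia
    refine Nat.le_of_mul_le_mul_left ?_ h2
    calc #P.parts * Fintype.card V ≤ 2 * k * #S * Fintype.card V := by gcongr
      _ = 2 * k * (#S * Fintype.card V) := by ring
      _ ≤ 2 * k * (2 * #P.parts * ∑ c' ∈ S, #c') := by gcongr
      _ = #P.parts * (4 * k * ∑ c' ∈ S, #(id c')) := by simp only [id]; ring
  · rw [R.pairCount_biUnion_right _ _ _ hdisj, card_biUnion hdisj]
    push_cast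
    rw [mul_sum, mul_sum]
    refine sum_le_sum fun c' hc' ↦ ?_
    rw [← R.edgeDensity_mul_card]
    have := (mem_filter.1 hc').2.2
    simp only [id]
    gcongr

end SparsePair

/-! ### Blue starbursts when red is `K_k`-free. -/

section Quasirandom

/-- The number of adjacent ordered pairs in every `A × B` is `p |A| |B|`, up to `γ |V|²`. -/
def SimpleGraph.IsQuasirandom {V : Type*} [Fintype V] (G : SimpleGraph V) (p γ : ℝ) : Prop :=
  ∀ A B : Finset V, |G.pairCount A B - p * (#A * #B)| ≤ γ * (Fintype.card V : ℝ) ^ 2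

theorem SimpleGraph.pairCount_sup_le {V : Type*} (G H : SimpleGraph V) (A B : Finset V) :
    (G ⊔ H).pairCount A B ≤ G.pairCount A B + H.pairCount A B := by
  classical
  unfold pairCount
  rw [← sum_add_distrib]
  refine sum_le_sum fun a _ ↦ ?_
  have h : (G ⊔ H).nbrs B a ⊆ G.nbrs B a ∪ H.nbrs B a := fun x ↦ by
    simp only [mem_nbrs, sup_adj, mem_union]
    tauto
  exact_mod_cast (card_le_card h).trans (card_union_le _ _)

theorem SimpleGraph.pairCount_le {V : Type*} (G : SimpleGraph V) (A B : Finset V) {c : ℝ}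
    (h : ∀ a ∈ A, (#(G.nbrs B a) : ℝ) ≤ c) : G.pairCount A B ≤ #A * c := by
  rw [← nsmul_eq_mul]
  exact sum_le_card_nsmul _ _ _ h

theorem SimpleGraph.le_pairCount {V : Type*} (G : SimpleGraph V) (A B : Finset V) {c : ℝ}
    (h : ∀ a ∈ A, c ≤ (#(G.nbrs B a) : ℝ)) : #A * c ≤ G.pairCount A B := by
  rw [← nsmul_eq_mul]
  exact card_nsmul_le_sum _ _ _ h

open Classical in
/-- If few pairs in `c × Y` are adjacent in `R`, then half of `c` has many neighbours in `Y` with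
respect to `B`. -/
theorem SimpleGraph.IsQuasirandom.card_le_two_mul {V : Type*} [Fintype V] {R B : SimpleGraph V}
    {p γ : ℝ} (h : (R ⊔ B).IsQuasirandom p γ) (hp : 0 < p) (c Y : Finset V) (hY : Y.Nonempty)
    (hR : R.pairCount c Y ≤ p / 8 * (#c * #Y))
    (hγ : γ * (Fintype.card V : ℝ) ^ 2 ≤ p / 8 * (#c * #Y)) :
    #c ≤ 2 * #{x ∈ c | p / 2 * #Y ≤ #(B.nbrs Y x)} := by
  set X : Finset V := {x ∈ c | ¬ p / 2 * #Y ≤ #(B.nbrs Y x)} with hX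
  have hcard : #{x ∈ c | p / 2 * #Y ≤ #(B.nbrs Y x)} + #X = #c :=
    card_filter_add_card_filter_not _
  have h1 := (abs_le.1 (h X Y)).1
  have h2 := pairCount_sup_le R B X Y
  have h3 : R.pairCount X Y ≤ R.pairCount c Y :=
    pairCount_mono le_rfl (filter_subset _ _) subset_rfl
  have h4 : B.pairCount X Y ≤ #X * (p / 2 * #Y) :=
    B.pairCount_le X Y fun x hx ↦ (not_le.1 (mem_filter.1 hx).2).le
  have hYpos : (0 : ℝ) < #Y := by exact_mod_cast hY.card_pos
  have h5 : p * #Y * (2 * #X) ≤ p * #Y * #c := by nlinarith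
  have h6 : (2 * #X : ℝ) ≤ #c := le_of_mul_le_mul_left h5 (by positivity)
  have h7 : 2 * #X ≤ #c := by exact_mod_cast h6
  lia

open Classical in
/-- The edges of `G` whose end points have at most `t` common neighbours in `Y`. -/
noncomputable def SimpleGraph.smallCodegree {V : Type*} (G : SimpleGraph V) (Y : Finset V)
    (t : ℝ) : SimpleGraph V where
  Adj x y := G.Adj x y ∧ (#(G.nbrs (G.nbrs Y x) y) : ℝ) ≤ t
  symm := ⟨fun x y h ↦ ⟨h.1.symm, by
    rw [show G.nbrs (G.nbrs Y y) x = G.nbrs (G.nbrs Y x) y by ext; simp [and_right_comm]]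
    exact h.2⟩⟩
  loopless := ⟨fun x h ↦ h.1.ne rfl⟩

/-- Quasirandomness is applied twice: few vertices `x` have over `2p|Y|` neighbours in `Y`, and for
any other `x` few vertices have over `4p²|Y|` neighbours in the neighbourhood of `x`. Dropping these
pairs costs only `O(γ / p³) |V|²`. -/
theorem SimpleGraph.IsQuasirandom.le_pairCount_smallCodegree {V : Type*} [Fintype V]
    {G : SimpleGraph V} {p γ : ℝ} (h : G.IsQuasirandom p γ) (hp : 0 < p) (hp1 : p ≤ 1 / 2)
    (hγ : 0 < γ) (Y : Finset V) (hY : 4 * p * Fintype.card V ≤ #Y) (A B : Finset V) :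
    p * (#A * #B) - γ / p ^ 3 * (Fintype.card V : ℝ) ^ 2 ≤
      (G.smallCodegree Y (4 * p ^ 2 * #Y)).pairCount A B := by
  classical
  set N : ℝ := (Fintype.card V : ℝ) with hN
  rcases (Nat.cast_nonneg (Fintype.card V) : (0 : ℝ) ≤ Fintype.card V).eq_or_lt with h0 | hNpos
  · have : IsEmpty V := Fintype.card_eq_zero_iff.1 (by exact_mod_cast h0.symm)
    simp [eq_empty_of_isEmpty A, hN, pairCount]
  rw [← hN] at hNpos
  have hle : ∀ S : Finset V, (#S : ℝ) ≤ N := fun S ↦ by rw [hN]; exact_mod_cast card_le_univ S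
  have hYpos : (0 : ℝ) < #Y := lt_of_lt_of_le (by positivity) hY
  set X₁ : Finset V := {x | 2 * p * #Y < #(G.nbrs Y x)} with hX₁
  have hX₁c : (#X₁ : ℝ) ≤ γ * N / (4 * p ^ 2) := by
    have h1 := (abs_le.1 (h X₁ Y)).2
    have h2 := G.le_pairCount X₁ Y fun x hx ↦ (mem_filter.1 hx).2.le
    have h3 : #X₁ * (p * #Y) ≤ γ * N ^ 2 := by linarith
    have h4 : (#X₁ : ℝ) * (p * (4 * p * N)) ≤ #X₁ * (p * #Y) := by gcongr
    rw [le_div_iff₀ (by positivity)]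
    refine le_of_mul_le_mul_right ?_ hNpos
    linarith
  let bad : V → Finset V := fun x ↦ {b ∈ B | 4 * p ^ 2 * #Y < #(G.nbrs (G.nbrs Y x) b)}
  have hbad : ∀ x ∉ X₁, (#(bad x) : ℝ) ≤ γ * N / (8 * p ^ 3) := by
    intro x hx
    have hdeg : (#(G.nbrs Y x) : ℝ) ≤ 2 * p * #Y := by simpa [hX₁] using hx
    have h1 := (abs_le.1 (h (bad x) (G.nbrs Y x))).2
    have h2 := G.le_pairCount (bad x) (G.nbrs Y x) (c := 4 * p ^ 2 * #Y) fun b hb ↦ by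
      exact (mem_filter.1 hb).2.le
    have h3 : p * (#(bad x) * #(G.nbrs Y x)) ≤ p * (#(bad x) * (2 * p * #Y)) := by gcongr
    have h4 : #(bad x) * (2 * p ^ 2 * #Y) ≤ γ * N ^ 2 := by linarith
    have h5 : (#(bad x) : ℝ) * (2 * p ^ 2 * (4 * p * N)) ≤ #(bad x) * (2 * p ^ 2 * #Y) := by gcongr
    rw [le_div_iff₀ (by positivity)]
    refine le_of_mul_le_mul_right ?_ hNpos
    linarith
  have hsum : ∑ a ∈ A, (#(bad a) : ℝ) ≤ #X₁ * N + N * (γ * N / (8 * p ^ 3)) := by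
    calc ∑ a ∈ A, (#(bad a) : ℝ)
        ≤ ∑ a ∈ A, ((if a ∈ X₁ then N else 0) + γ * N / (8 * p ^ 3)) := by
          refine sum_le_sum fun a _ ↦ ?_
          split_ifs with ha
          · linarith [hle (bad a), (by positivity : 0 ≤ γ * N / (8 * p ^ 3))]
          · simpa using hbad a ha
      _ ≤ #X₁ * N + N * (γ * N / (8 * p ^ 3)) := by
          rw [sum_add_distrib, sum_ite, sum_const, sum_const_zero, sum_const, nsmul_eq_mul,
            nsmul_eq_mul, add_zero]
          have h1 : #{a ∈ A | a ∈ X₁} ≤ #X₁ := card_le_card fun a ha ↦ (mem_filter.1 ha).2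
          have h2 := hle A
          gcongr
  have hsplit : G.pairCount A B ≤ (G.smallCodegree Y (4 * p ^ 2 * #Y)).pairCount A B +
      ∑ a ∈ A, (#(bad a) : ℝ) := by
    unfold pairCount
    rw [← sum_add_distrib]
    refine sum_le_sum fun a _ ↦ ?_
    have : #(G.nbrs B a) ≤
        #((G.smallCodegree Y (4 * p ^ 2 * #Y)).nbrs B a) + #(bad a) := by
      refine (card_le_card fun b hb ↦ ?_).trans (card_union_le _ _)
      rw [mem_nbrs] at hb
      rw [mem_union, mem_nbrs]
      rcases le_or_gt (#(G.nbrs (G.nbrs Y a) b) : ℝ) (4 * p ^ 2 * #Y) with hle | hgt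
      exacts [.inl ⟨hb.1, hb.2, hle⟩, .inr (mem_filter.2 ⟨hb.1, hgt⟩)]
    exact_mod_cast this
  have h1 := (abs_le.1 (h A B)).1
  have h2 : #X₁ * N ≤ γ * N / (4 * p ^ 2) * N := by gcongr
  have h3 : γ * N / (4 * p ^ 2) * N + N * (γ * N / (8 * p ^ 3)) + γ * N ^ 2 ≤
      γ / p ^ 3 * N ^ 2 := by
    have e1 : γ * N / (4 * p ^ 2) * N + N * (γ * N / (8 * p ^ 3)) + γ * N ^ 2 =
      γ * N ^ 2 / p ^ 3 * (p / 4 + 1 / 8 + p ^ 3) := by field_simp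
    have e2 : γ / p ^ 3 * N ^ 2 = γ * N ^ 2 / p ^ 3 * 1 := by ring
    rw [e1, e2]
    have : p ^ 3 ≤ (1 / 2) ^ 3 := pow_le_pow_left₀ hp.le hp1 3
    gcongr
    linarith
  linarith

/-- Each clique vertex loses at most `k * 4p²|Y| = p|Y|/4` of its at least `p|Y|/2` blue neighbours
when those shared with other clique vertices are discarded. -/
theorem starburst_isContained_of_small_codegree {k n : ℕ} {V : Type*} {R B : SimpleGraph V}
    {p : ℝ} (hp : 16 * k * p = 1) {Y t : Finset V} (ht : B.IsNClique k t)
    (hdeg : ∀ x ∈ t, p / 2 * #Y ≤ #(B.nbrs Y x))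
    (hcodeg : ∀ x ∈ t, ∀ y ∈ t, x ≠ y →
      ((R ⊔ B).smallCodegree Y (4 * p ^ 2 * #Y)).Adj x y)
    (hn : n + k ≤ p / 4 * #Y) : (starburst k n).IsContained B := by
  classical
  let e : Fin k ≃ t := (t.equivFinOfCardEq ht.card_eq).symm
  have hne : ∀ i j, i ≠ j → (e i).1 ≠ (e j).1 := fun i j hij h ↦ hij (e.injective (Subtype.ext h))
  let C : Fin k → Fin k → Finset V := fun i j ↦
    (R ⊔ B).nbrs ((R ⊔ B).nbrs Y (e i)) (e j)
  refine starburst_isContained_of_pairwiseDisjoint (fun i ↦ (e i).1)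
    (fun i j hij ↦ ht.isClique (e i).2 (e j).2 (hne i j hij))
    (fun i ↦ B.nbrs Y (e i) \ (univ.erase i).biUnion (C i)) ?_ ?_ ?_
  · intro i w hw
    exact (SimpleGraph.mem_nbrs.1 (mem_sdiff.1 hw).1).2
  · intro i j hij
    rw [disjoint_left]
    intro w hi hj
    obtain ⟨hi1, hi2⟩ := mem_sdiff.1 hi
    refine hi2 (mem_biUnion.2 ⟨j, by simp [hij.symm], ?_⟩)
    have h1 := SimpleGraph.mem_nbrs.1 hi1
    have h2 := SimpleGraph.mem_nbrs.1 (mem_sdiff.1 hj).1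
    exact SimpleGraph.mem_nbrs.2 ⟨SimpleGraph.mem_nbrs.2 ⟨h1.1, .inr h1.2⟩, .inr h2.2⟩
  · intro i
    have h1 := le_card_sdiff ((univ.erase i).biUnion (C i)) (B.nbrs Y (e i))
    have h2 : #((univ.erase i).biUnion (C i)) ≤ ∑ j ∈ univ.erase i, #(C i j) := card_biUnion_le
    have h3 : ∑ j ∈ univ.erase i, (#(C i j) : ℝ) ≤ k * (4 * p ^ 2 * #Y) := by
      refine (sum_le_card_nsmul _ _ (4 * p ^ 2 * #Y) fun j hj ↦ ?_).trans ?_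
      · exact (hcodeg _ (e i).2 _ (e j).2 (hne i j (mem_erase.1 hj).1.symm)).2
      · rw [nsmul_eq_mul]
        gcongr
        exact (card_erase_le).trans (by simp)
    have h4 := hdeg _ (e i).2
    have h5 : (#(B.nbrs Y (e i)) : ℝ) ≤
        #(B.nbrs Y (e i) \ (univ.erase i).biUnion (C i)) +
          ∑ j ∈ univ.erase i, (#(C i j) : ℝ) := by
      exact_mod_cast (by omega : #(B.nbrs Y (e i)) ≤
        #(B.nbrs Y (e i) \ (univ.erase i).biUnion (C i)) +
          ∑ j ∈ univ.erase i, #(C i j))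
    have h6 : (k : ℝ) * (4 * p ^ 2 * #Y) = p / 4 * #Y := by
      linear_combination p / 4 * #Y * hp
    have h7 : ((n + k : ℕ) : ℝ) ≤
        #(B.nbrs Y (e i) \ (univ.erase i).biUnion (C i)) := by
      push_cast
      linarith
    exact_mod_cast h7

theorem exists_starburst_of_isQuasirandom {k : ℕ} (hk : 2 ≤ k) :
    ∃ γ : ℝ, 0 < γ ∧ ∃ N₀ : ℕ, ∀ (V : Type) [Fintype V] (R B : SimpleGraph V) (n : ℕ),
      N₀ ≤ Fintype.card V → (R ⊔ B).IsQuasirandom (1 / (16 * k)) γ → R.CliqueFree k →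
      256 * k ^ 2 * (n + k) ≤ Fintype.card V → (starburst k n).IsContained B := by
  classical
  have hk2 : (2 : ℝ) ≤ k := by exact_mod_cast hk
  set p : ℝ := 1 / (16 * k) with hpdef
  have hp : 0 < p := by positivity
  have hpk : 16 * k * p = 1 := by rw [hpdef]; field_simp
  have hp1 : p ≤ 1 / 2 := by nlinarith
  obtain ⟨M, hM, hpair⟩ := exists_sparse_pair hk (d := p / 8) (by positivity) (by linarith)
  set r : ℕ := 2 ^ (k + k) with hr
  have hrpos : (0 : ℝ) < r := by positivity
  have hr1 : (1 : ℝ) ≤ r := by exact_mod_cast Nat.one_le_two_pow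
  have hM1 : (1 : ℝ) ≤ M := by exact_mod_cast hM
  set θ : ℝ := (p / 2) ^ r / r with hθdef
  have hθ : 0 < θ := by positivity
  have hθ1 : θ ≤ 1 := by
    rw [hθdef, div_le_one hrpos]
    exact (pow_le_one₀ (by positivity) (by linarith)).trans hr1
  -- With this choice the error `γ / p³ * N²` is half the main term `p * (#A' * #B')` for sets of
  -- size `θN / (2M)`, leaving density `p / 2`.
  set γ : ℝ := p ^ 4 / 2 * (θ / (2 * M)) ^ 2 with hγdef
  have hγ : 0 < γ := by positivity
  refine ⟨γ, hγ, M, fun V _ R B n hV hQ hR hn ↦ ?_⟩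
  obtain ⟨c, Y, hc, hY, hRc⟩ := hpair V R hV hR
  set N : ℝ := (Fintype.card V : ℝ) with hN
  have hNpos : 0 < N := by
    rw [hN]
    exact_mod_cast (by lia : 0 < Fintype.card V)
  have hne : Nonempty V := Fintype.card_pos_iff.1 (by lia)
  have hc' : N ≤ M * #c := by rw [hN]; exact_mod_cast hc
  have hY' : 4 * p * N ≤ #Y := by
    have : N ≤ 4 * k * #Y := by rw [hN]; exact_mod_cast hY
    nlinarith
  have hYne : Y.Nonempty := by
    rw [← card_pos]
    exact Nat.cast_pos.1 (lt_of_lt_of_le (by positivity : 0 < 4 * p * N) hY')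
  have hγ1 : γ * N ^ 2 ≤ p / 8 * (#c * #Y) := by
    have h1 : N / M ≤ #c := by rw [div_le_iff₀ (by positivity)]; linarith
    have h2 : p / 8 * (N / M * (4 * p * N)) ≤ p / 8 * (#c * #Y) := by gcongr
    refine le_trans ?_ h2
    have e1 : γ * N ^ 2 = p ^ 2 * N ^ 2 / (2 * M) * (p ^ 2 * θ ^ 2 / (4 * M)) := by
      rw [hγdef]; field_simp; ring
    have e2 : p / 8 * (N / M * (4 * p * N)) = p ^ 2 * N ^ 2 / (2 * M) * 1 := by field_simp; ring
    rw [e1, e2]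
    gcongr
    rw [div_le_one (by positivity)]
    have : p ^ 2 * θ ^ 2 ≤ 1 * 1 := by
      gcongr
      · exact pow_le_one₀ hp.le (by linarith)
      · exact pow_le_one₀ hθ.le hθ1
    linarith
  have hhalf := hQ.card_le_two_mul hp c Y hYne hRc hγ1
  set C : Finset V := {x ∈ c | p / 2 * #Y ≤ #(B.nbrs Y x)} with hC
  have hhalf' : (#c : ℝ) ≤ 2 * #C := by exact_mod_cast hhalf
  have hCc : N / (2 * M) ≤ #C := by
    rw [div_le_iff₀ (by positivity)]
    nlinarith
  have hCne : C.Nonempty := by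
    rw [← card_pos]
    exact Nat.cast_pos.1 (lt_of_lt_of_le (by positivity : 0 < N / (2 * M)) hCc)
  set G' := (R ⊔ B).smallCodegree Y (4 * p ^ 2 * #Y) with hG'
  -- All `r` parts are the same set `C`; adjacency makes the chosen vertices distinct.
  obtain ⟨v, hvC, hv⟩ := G'.exists_transversal_clique (half_pos hp) (by linarith)
    (univ : Finset (Fin r)) (fun _ ↦ C) θ hθ
    (by rw [card_univ, Fintype.card_fin, hθdef, mul_div_cancel₀ _ hrpos.ne'])
    (fun _ _ ↦ hCne) (fun _ _ _ _ _ A' _ B' _ hA hB ↦ by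
      have h1 := hQ.le_pairCount_smallCodegree hp hp1 hγ Y hY' A' B'
      have h2 : θ * (N / (2 * M)) ≤ #A' := le_trans (by gcongr) hA
      have h3 : θ * (N / (2 * M)) ≤ #B' := le_trans (by gcongr) hB
      have h4 : p / 2 * ((θ * (N / (2 * M))) * (θ * (N / (2 * M)))) ≤ p / 2 * (#A' * #B') := by
        gcongr
      have h5 : γ / p ^ 3 * N ^ 2 = p / 2 * ((θ * (N / (2 * M))) * (θ * (N / (2 * M)))) := by
        rw [hγdef]; field_simp
      linarith)
  have hvinj : Function.Injective v := by
    intro i j hij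
    by_contra hne
    exact (hv i (mem_univ _) j (mem_univ _) hne).ne hij
  have hv' : ∀ x ∈ univ.image v, ∀ y ∈ univ.image v, x ≠ y → G'.Adj x y := by
    intro x hx y hy hxy
    simp only [mem_image, mem_univ, true_and] at hx hy
    obtain ⟨i, rfl⟩ := hx
    obtain ⟨j, rfl⟩ := hy
    exact hv i (mem_univ _) j (mem_univ _) fun h ↦ hxy (h ▸ rfl)
  rcases exists_isNClique_of_two_pow_le_card R B (k + k) k k rfl (univ.image v)
    (by rw [card_image_of_injective _ hvinj, card_univ, Fintype.card_fin])
    (fun x hx y hy hxy ↦ (hv' x hx y hy hxy).1) with ⟨t, -, htR⟩ | ⟨t, ht, htB⟩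
  · exact (hR t htR).elim
  · refine starburst_isContained_of_small_codegree (R := R) hpk (Y := Y) htB (fun x hx ↦ ?_)
      (fun x hx y hy ↦ hv' x (ht hx) y (ht hy)) ?_
    · obtain ⟨i, -, rfl⟩ := mem_image.1 (ht hx)
      exact (mem_filter.1 (hvC i (mem_univ _))).2
    · have h1 : (256 : ℝ) * k ^ 2 * (n + k) ≤ N := by rw [hN]; exact_mod_cast hn
      have h2 : p / 4 * (4 * p * N) ≤ p / 4 * #Y := by gcongr
      have h3 : p ^ 2 * (256 * k ^ 2 * (n + k)) ≤ p ^ 2 * N := by gcongr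
      have h4 : p ^ 2 * (256 * k ^ 2 * ((n : ℝ) + k)) = (16 * k * p) ^ 2 * (n + k) := by ring
      rw [h4, hpk] at h3
      linarith

end Quasirandom

/-! ### An explicit quasirandom graph of density `1 / q`. -/

section Construction

/-- Vertices are triples `(x, h, s)` with `h : X → ZMod q`; the triples `(x, h, s)` and `(y, g, t)`
are adjacent when `x ≠ y` and `h y + g x = 0`. -/
def crossSumGraph (X : Type) (q : ℕ) (S : Type) : SimpleGraph (X × (X → ZMod q) × S) where
  Adj v w := v.1 ≠ w.1 ∧ v.2.1 w.1 + w.2.1 v.1 = 0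
  symm := ⟨fun _ _ h ↦ ⟨h.1.symm, by rw [add_comm]; exact h.2⟩⟩
  loopless := ⟨fun _ h ↦ h.1 rfl⟩

/-- Distinct coordinates of a uniform `h` are independent: translating coordinate `y` by `c`
preserves the sum and the factor `w (h y')`, and averaging over `c` annihilates `u`. -/
theorem sum_pi_mul_eq_zero {X A : Type*} [Fintype X] [DecidableEq X] [AddGroup A] [Fintype A]
    {y y' : X} (hy : y ≠ y') (u w : A → ℝ) (hu : ∑ c, u c = 0) :
    ∑ h : X → A, u (h y) * w (h y') = 0 := by
  have h1 : ∀ c : A, ∑ h : X → A, u (h y) * w (h y') =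
      ∑ h : X → A, u (h y + c) * w (h y') := by
    intro c
    rw [← Equiv.sum_comp (Equiv.addRight (Pi.single y c))]
    refine sum_congr rfl fun h _ ↦ ?_
    simp [Pi.single_eq_of_ne hy.symm]
  have h2 : ∑ _c : A, ∑ h : X → A, u (h y) * w (h y') = 0 := by
    rw [sum_congr rfl fun c _ ↦ h1 c, sum_comm]
    refine sum_eq_zero fun h _ ↦ ?_
    rw [← sum_mul]
    have h3 : ∑ c, u (h y + c) = ∑ c, u c := Equiv.sum_comp (Equiv.addLeft (h y)) u
    rw [h3, hu, zero_mul]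
  rw [sum_const, nsmul_eq_mul] at h2
  have : (#(univ : Finset A) : ℝ) ≠ 0 := by
    rw [card_univ]
    exact_mod_cast Fintype.card_ne_zero
  exact (mul_eq_zero.1 h2).resolve_left this

variable {X S : Type} {q : ℕ}

open Classical in
/-- The adjacency indicator of `crossSumGraph`, less its average. -/
noncomputable def crossSumDeviation (v w : X × (X → ZMod q) × S) : ℝ :=
  (if (crossSumGraph X q S).Adj v w then 1 else 0) - 1 / q

theorem abs_crossSumDeviation_le [NeZero q] (v w : X × (X → ZMod q) × S) :
    |crossSumDeviation v w| ≤ 1 := by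
  have hq : (1 : ℝ) ≤ q := by exact_mod_cast NeZero.one_le
  have h1 : (0 : ℝ) < 1 / q := by positivity
  have h2 : (1 : ℝ) / q ≤ 1 := by rw [div_le_one (by linarith)]; exact hq
  unfold crossSumDeviation
  rw [abs_le]
  split_ifs <;> constructor <;> linarith

theorem crossSumDeviation_mul_le [NeZero q] (v w w' : X × (X → ZMod q) × S) :
    crossSumDeviation v w * crossSumDeviation v w' ≤ 1 := by
  refine (le_abs_self _).trans ?_
  rw [abs_mul]
  exact mul_le_one₀ (abs_crossSumDeviation_le _ _) (abs_nonneg _) (abs_crossSumDeviation_le _ _)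

theorem sum_crossSumDeviation_mul_eq_zero [Fintype X] [DecidableEq X] [Fintype S] [NeZero q] {x : X}
    {b b' : X × (X → ZMod q) × S} (hbb : b.1 ≠ b'.1) (hb : x ≠ b.1) (hb' : x ≠ b'.1) :
    ∑ z : (X → ZMod q) × S, crossSumDeviation (x, z) b * crossSumDeviation (x, z) b' = 0 := by
  classical
  rw [Fintype.sum_prod_type_right]
  refine sum_eq_zero fun s _ ↦ ?_
  have hq : (q : ℝ) ≠ 0 := NeZero.ne _
  rw [← sum_pi_mul_eq_zero hbb (fun c : ZMod q ↦ (if c + b.2.1 x = 0 then (1 : ℝ) else 0) - 1 / q)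
    (fun c : ZMod q ↦ (if c + b'.2.1 x = 0 then (1 : ℝ) else 0) - 1 / q)]
  · refine sum_congr rfl fun h _ ↦ ?_
    simp only [crossSumDeviation, crossSumGraph, ne_eq, hb, hb', not_false_eq_true, true_and]
  · simp only [sum_sub_distrib, add_eq_zero_iff_eq_neg, sum_ite_eq', mem_univ, if_true, sum_const,
      card_univ, ZMod.card, nsmul_eq_mul]
    field_simp
    simp

theorem sum_crossSumDeviation_mul_le [Fintype X] [DecidableEq X] [Fintype S] [NeZero q]
    (b b' : X × (X → ZMod q) × S) :
    ∑ a, crossSumDeviation a b * crossSumDeviation a b' ≤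
      2 * (Fintype.card ((X → ZMod q) × S) : ℝ) +
        if b.1 = b'.1 then (Fintype.card (X × (X → ZMod q) × S) : ℝ) else 0 := by
  set m : ℝ := ((Fintype.card ((X → ZMod q) × S) : ℕ) : ℝ) with hm
  have hm0 : 0 ≤ m := Nat.cast_nonneg _
  have hle : ∀ x, ∑ z : (X → ZMod q) × S, crossSumDeviation (x, z) b *
      crossSumDeviation (x, z) b' ≤ m := by
    intro x
    refine (sum_le_card_nsmul _ _ 1 fun z _ ↦ crossSumDeviation_mul_le _ _ _).trans ?_
    simp [hm]
  rw [Fintype.sum_prod_type]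
  by_cases hbb : b.1 = b'.1
  · rw [if_pos hbb, Fintype.card_prod, Nat.cast_mul, ← hm]
    refine (sum_le_card_nsmul _ _ m fun x _ ↦ hle x).trans ?_
    rw [card_univ, nsmul_eq_mul]
    linarith
  · rw [if_neg hbb, add_zero]
    calc _ ≤ ∑ x, ((if x = b.1 then m else 0) + if x = b'.1 then m else 0) := by
          refine sum_le_sum fun x _ ↦ ?_
          by_cases h1 : x = b.1
          · rw [if_pos h1]
            refine (hle x).trans ?_
            split_ifs <;> linarith
          · by_cases h2 : x = b'.1
            · rw [if_pos h2, if_neg h1]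
              simpa using hle x
            · rw [if_neg h1, if_neg h2, sum_crossSumDeviation_mul_eq_zero hbb h1 h2, add_zero]
      _ = 2 * m := by
          rw [sum_add_distrib, sum_ite_eq', sum_ite_eq']
          simp only [mem_univ, if_true]
          ring

/-- Cauchy–Schwarz reduces the discrepancy to correlations of pairs `b, b'`. These vanish unless two
of the three `X`-coordinates coincide, which happens for an `O(1 / |X|)` fraction of triples. -/
theorem isQuasirandom_crossSumGraph [Fintype X] [DecidableEq X] [Fintype S] [NeZero q]
    {γ : ℝ} (hγ : 0 < γ)
    (hX : 3 ≤ γ ^ 2 * Fintype.card X) : (crossSumGraph X q S).IsQuasirandom (1 / q) γ := by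
  classical
  intro A B
  set N : ℝ := ((Fintype.card (X × (X → ZMod q) × S) : ℕ) : ℝ) with hN
  set m : ℝ := ((Fintype.card ((X → ZMod q) × S) : ℕ) : ℝ) with hm
  have hm0 : 0 ≤ m := Nat.cast_nonneg _
  have hN0 : 0 ≤ N := Nat.cast_nonneg _
  have hNm : N = Fintype.card X * m := by rw [hN, Fintype.card_prod, Nat.cast_mul]
  have hdev : (crossSumGraph X q S).pairCount A B - 1 / q * (#A * #B) =
      ∑ a ∈ A, ∑ b ∈ B, crossSumDeviation a b := by
    unfold SimpleGraph.pairCount SimpleGraph.nbrs crossSumDeviation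
    simp only [sum_sub_distrib, card_filter, sum_const, nsmul_eq_mul]
    push_cast
    ring
  have hcs : (∑ a ∈ A, ∑ b ∈ B, crossSumDeviation a b) ^ 2 ≤
      N * ∑ a, (∑ b ∈ B, crossSumDeviation a b) ^ 2 := by
    refine (sq_sum_le_card_mul_sum_sq).trans ?_
    have h1 : (#A : ℝ) ≤ N := by rw [hN]; exact_mod_cast card_le_univ A
    have h2 := sum_le_univ_sum_of_nonneg (s := A) (f := fun a ↦ (∑ b ∈ B, crossSumDeviation a b) ^ 2)
      fun a ↦ sq_nonneg _
    exact mul_le_mul h1 h2 (sum_nonneg fun _ _ ↦ sq_nonneg _) hN0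
  have hexp : ∑ a, (∑ b ∈ B, crossSumDeviation a b) ^ 2 =
      ∑ b ∈ B, ∑ b' ∈ B, ∑ a, crossSumDeviation a b * crossSumDeviation a b' := by
    simp only [sq, sum_mul_sum]
    rw [sum_comm]
    exact sum_congr rfl fun b _ ↦ sum_comm
  have hrow : ∀ b : X × (X → ZMod q) × S,
      ∑ b' ∈ B, (2 * m + if b.1 = b'.1 then N else 0) ≤ 3 * m * N := by
    intro b
    refine (sum_le_univ_sum_of_nonneg fun b' ↦ ?_).trans ?_
    · split_ifs <;> positivity
    · rw [sum_add_distrib, sum_const, nsmul_eq_mul, card_univ, ← hN, Fintype.sum_prod_type]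
      have h1 : ∀ x, ∑ z : (X → ZMod q) × S, (if b.1 = (x, z).1 then N else 0) =
          if b.1 = x then m * N else 0 := by
        intro x
        by_cases h : b.1 = x
        · simp only [h, if_true, sum_const, card_univ, nsmul_eq_mul, hm]
        · simp only [h, if_false, sum_const_zero]
      rw [sum_congr rfl fun x _ ↦ h1 x, sum_ite_eq, if_pos (mem_univ _)]
      linarith
  have hsum : ∑ a, (∑ b ∈ B, crossSumDeviation a b) ^ 2 ≤ N * (3 * m * N) := by
    rw [hexp]
    calc _ ≤ ∑ b ∈ B, 3 * m * N := sum_le_sum fun b _ ↦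
          (sum_le_sum fun b' _ ↦ sum_crossSumDeviation_mul_le b b').trans (hrow b)
      _ ≤ N * (3 * m * N) := by
          rw [sum_const, nsmul_eq_mul]
          have h1 : (#B : ℝ) ≤ N := by rw [hN]; exact_mod_cast card_le_univ B
          gcongr
  rw [hdev]
  refine abs_le_of_sq_le_sq (hcs.trans ?_) (by positivity)
  calc N * ∑ a, (∑ b ∈ B, crossSumDeviation a b) ^ 2 ≤ N * (N * (3 * m * N)) := by gcongr
    _ = N ^ 3 * m * 3 := by ring
    _ ≤ N ^ 3 * m * (γ ^ 2 * Fintype.card X) := by gcongr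
    _ = (γ * N ^ 2) ^ 2 := by rw [hNm]; ring

/-- The factor `Fin t` blows the graph up, so its order can be any multiple of a fixed `D` while `γ`
stays the same. -/
theorem exists_isQuasirandom (q : ℕ) [NeZero q] {γ : ℝ} (hγ : 0 < γ) :
    ∃ D : ℕ, 0 < D ∧ ∀ t : ℕ, ∃ (V : Type) (_ : Fintype V) (G : SimpleGraph V),
      Fintype.card V = D * t ∧ G.IsQuasirandom (1 / q) γ := by
  obtain ⟨T, hT⟩ := exists_nat_gt (3 / γ ^ 2)
  have hT0 : 0 < T := by
    have : (0 : ℝ) < T := lt_of_le_of_lt (by positivity) hT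
    exact_mod_cast this
  refine ⟨T * q ^ T, Nat.mul_pos hT0 (pow_pos (NeZero.pos q) T), fun t ↦
    ⟨Fin T × (Fin T → ZMod q) × Fin t, inferInstance, crossSumGraph _ _ _, ?_,
      isQuasirandom_crossSumGraph hγ ?_⟩⟩
  · simp [ZMod.card, mul_assoc]
  · rw [Fintype.card_fin, mul_comm, ← div_le_iff₀ (by positivity)]
    exact hT.le

end Construction

/-! ### The Ramsey property of the host, and the bounds on the size Ramsey number. -/

section UpperBound

theorem SimpleGraph.pairCount_comap {V W : Type*} (G : SimpleGraph V) (f : W ↪ V)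
    (A B : Finset W) : (G.comap f).pairCount A B = G.pairCount (A.map f) (B.map f) := by
  unfold pairCount
  rw [sum_map]
  refine sum_congr rfl fun a _ ↦ ?_
  rw [← card_map f]
  congr 2
  ext x
  simp only [mem_map, mem_nbrs, comap_adj]
  grind

theorem SimpleGraph.IsQuasirandom.comap {V : Type*} [Fintype V] {G : SimpleGraph V} {p γ : ℝ}
    (h : G.IsQuasirandom p γ) (hγ : 0 ≤ γ) (W : Finset V) (hW : Fintype.card V ≤ 3 * #W) :
    (G.comap (Function.Embedding.subtype (· ∈ W))).IsQuasirandom p (9 * γ) := by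
  intro A B
  have h1 := h (A.map (Function.Embedding.subtype _)) (B.map (Function.Embedding.subtype _))
  rw [← G.pairCount_comap, card_map, card_map] at h1
  refine h1.trans ?_
  have h2 : (Fintype.card V : ℝ) ≤ 3 * Fintype.card W := by
    rw [Fintype.card_coe]
    exact_mod_cast hW
  calc γ * (Fintype.card V : ℝ) ^ 2 ≤ γ * (3 * Fintype.card W) ^ 2 := by gcongr
    _ = 9 * γ * (Fintype.card W : ℝ) ^ 2 := by ring

theorem exists_isRamseyFor_of_isQuasirandom {k : ℕ} (hk : 2 ≤ k) :
    ∃ γ : ℝ, 0 < γ ∧ γ ≤ 1 / (16 * k) ∧ ∃ n₀ : ℕ, ∀ (V : Type) [Fintype V] (G : SimpleGraph V)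
      (n : ℕ), n₀ ≤ n → G.IsQuasirandom (1 / (16 * k)) γ → 800 * k ^ 2 * n ≤ Fintype.card V →
        IsRamseyFor G (starburst k n) := by
  classical
  obtain ⟨γ₀, hγ₀, N₀, hmain⟩ := exists_starburst_of_isQuasirandom hk
  have hk2 : (2 : ℝ) ≤ k := by exact_mod_cast hk
  set p : ℝ := 1 / (16 * k) with hpdef
  have hp : 0 < p := by positivity
  have hpk : 16 * k * p = 1 := by rw [hpdef]; field_simp
  -- Restricting to a third of the vertices multiplies `γ` by 9; `p / 6` makes the low-degree
  -- vertices at most a third of `V`. The bound `24 * k ≤ n` gives `256 (n + k) ≤ 800 n / 3`.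
  refine ⟨min (γ₀ / 9) (p / 6), by positivity, (min_le_right _ _).trans (by linarith),
    max N₀ (24 * k), fun V _ G n hn hG hV χ ↦ ?_⟩
  set γ := min (γ₀ / 9) (p / 6) with hγdef
  have hγ : 0 < γ := by positivity
  have hγ1 : γ ≤ p / 6 := min_le_right _ _
  have hγ2 : 9 * γ ≤ γ₀ := by linarith [min_le_left (γ₀ / 9) (p / 6)]
  have hn0 : N₀ ≤ n := (le_max_left _ _).trans hn
  have hnk : 24 * k ≤ n := (le_max_right _ _).trans hn
  have key : ∀ R B : SimpleGraph V, R ⊔ B = G →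
      Fintype.card V ≤ 3 * #{v | k * n + k ≤ #(R.nbrs univ v)} →
      (starburst k n).IsContained R ∨ (starburst k n).IsContained B := by
    intro R B hRB hW
    set W : Finset V := {v | k * n + k ≤ #(R.nbrs univ v)} with hWdef
    let f := Function.Embedding.subtype (· ∈ W)
    by_cases hfree : (R.comap f).CliqueFree k
    · right
      have hq : (R.comap f ⊔ B.comap f).IsQuasirandom p γ₀ := by
        have h1 : R.comap f ⊔ B.comap f = G.comap f := by rw [← hRB]; rfl
        rw [h1]
        intro A B
        exact (hG.comap hγ.le W hW A B).trans (by gcongr)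
      have hcard : 256 * k ^ 2 * (n + k) ≤ #W := by nlinarith [Nat.mul_le_mul_left (k ^ 2) hnk]
      have hk1 : 1 ≤ k ^ 2 := Nat.one_le_pow _ _ (by lia)
      have := hmain W (R.comap f) (B.comap f) n
        (by rw [Fintype.card_coe]; nlinarith) hq hfree (by rwa [Fintype.card_coe])
      exact this.trans ⟨(SimpleGraph.Embedding.comap f B).toCopy⟩
    · left
      obtain ⟨t, ht⟩ : ∃ t, (R.comap f).IsNClique k t := by
        simpa [SimpleGraph.CliqueFree] using hfree
      let e : Fin k ≃ t := (t.equivFinOfCardEq ht.card_eq).symm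
      refine starburst_isContained_of_card_le (fun i ↦ f (e i)) (fun i j hij ↦ ?_)
        (fun i ↦ R.nbrs univ (f (e i))) (fun i w hw ↦ (SimpleGraph.mem_nbrs.1 hw).2)
        (fun i ↦ (mem_filter.1 (e i).1.2).2)
      exact ht.isClique (e i).2 (e j).2 fun h ↦ hij (e.injective (Subtype.ext h))
  have hsup : χ.labelGraph 0 ⊔ χ.labelGraph 1 = G := by
    refine Eq.trans ?_ χ.iSup_labelGraph
    ext x y
    simp [SimpleGraph.iSup_adj, Fin.exists_fin_two]
  set W : Fin 2 → Finset V := fun c ↦ {v | k * n + k ≤ #((χ.labelGraph c).nbrs univ v)} with hW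
  have hlarge : 2 * Fintype.card V ≤ 3 * (#(W 0) + #(W 1)) := by
    set N : ℝ := (Fintype.card V : ℝ) with hN
    have hV' : 800 * (k : ℝ) ^ 2 * n ≤ N := by rw [hN]; exact_mod_cast hV
    have hnk' : 24 * (k : ℝ) ≤ n := by exact_mod_cast hnk
    have hNpos : 0 < N := lt_of_lt_of_le (by nlinarith [sq_nonneg (k : ℝ)]) hV'
    -- A vertex outside `U` has degree above `2(kn + k)`, hence degree at least `kn + k` in some
    -- colour.
    let U : Finset V := {v | #(G.nbrs univ v) ≤ 2 * (k * n + k)}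
    have hcover : (univ : Finset V) ⊆ U ∪ (W 0 ∪ W 1) := by
      intro v _
      simp only [U, hW, mem_union, mem_filter, mem_univ, true_and]
      by_contra! hcon
      have h1 : #(G.nbrs univ v) ≤ #((χ.labelGraph 0).nbrs univ v) +
          #((χ.labelGraph 1).nbrs univ v) := by
        refine (card_le_card fun w hw ↦ ?_).trans (card_union_le _ _)
        rw [← hsup] at hw
        simpa using hw
      lia
    have hU : 3 * #U ≤ Fintype.card V := by
      have h1 := (abs_le.1 (hG U univ)).1
      have h2 := G.pairCount_le U univ (c := 2 * (k * n + k)) fun v hv ↦ by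
        exact_mod_cast (mem_filter.1 hv).2
      rw [card_univ, ← hN] at h1
      have h3 : p * (800 * k ^ 2 * n) ≤ p * N := by gcongr
      have h4 : p * (800 * (k : ℝ) ^ 2 * n) = 50 * k * n := by
        linear_combination 50 * k * n * hpk
      have h5 : 2 * ((k : ℝ) * n + k) ≤ p * N / 2 := by nlinarith
      have h6 : (#U : ℝ) * (2 * (k * n + k)) ≤ #U * (p * N / 2) := by gcongr
      have h7 : γ * N ^ 2 ≤ p / 6 * N ^ 2 := by gcongr
      have h8 : (3 * #U : ℝ) * (p * N) ≤ N * (p * N) := by nlinarith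
      have h9 : (3 * #U : ℝ) ≤ N := le_of_mul_le_mul_right h8 (by positivity)
      rw [hN] at h9
      exact_mod_cast h9
    have h1 := card_le_card hcover
    rw [card_univ] at h1
    have h2 := card_union_le U (W 0 ∪ W 1)
    have h3 := card_union_le (W 0) (W 1)
    omega
  have hcase : Fintype.card V ≤ 3 * #(W 0) ∨ Fintype.card V ≤ 3 * #(W 1) := by omega
  rcases hcase with h | h
  · rcases key _ _ hsup h with h | h
    exacts [⟨0, h⟩, ⟨1, h⟩]
  · rcases key _ _ ((sup_comm _ _).trans hsup) h with h | h
    exacts [⟨1, h⟩, ⟨0, h⟩]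

theorem SimpleGraph.IsQuasirandom.ncard_edgeSet_le {V : Type*} [Fintype V] {G : SimpleGraph V}
    {p γ : ℝ} (h : G.IsQuasirandom p γ) (hγ : γ ≤ p) :
    (G.edgeSet.ncard : ℝ) ≤ p * (Fintype.card V : ℝ) ^ 2 := by
  classical
  have h1 := (abs_le.1 (h univ univ)).2
  have h2 : G.pairCount univ univ = 2 * G.edgeSet.ncard := by
    rw [G.ncard_edgeSet]
    have := G.sum_degrees_eq_twice_card_edges
    have h3 : (2 * #G.edgeFinset : ℝ) = ∑ v, (G.degree v : ℝ) := by exact_mod_cast this.symm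
    rw [h3]
    refine sum_congr rfl fun v _ ↦ ?_
    rw [← card_neighborFinset_eq_degree]
    congr 2
    ext w
    simp
  rw [h2, card_univ] at h1
  have h3 : γ * (Fintype.card V : ℝ) ^ 2 ≤ p * (Fintype.card V : ℝ) ^ 2 := by gcongr
  linarith

theorem exists_isRamseyFor_starburst {k : ℕ} (hk : 2 ≤ k) :
    ∃ n₀ : ℕ, ∀ n : ℕ, n₀ ≤ n → ∃ (V : Type) (_ : Fintype V) (G : SimpleGraph V),
      IsRamseyFor G (starburst k n) ∧ G.edgeSet.ncard ≤ 10 ^ 5 * k ^ 3 * n ^ 2 := by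
  obtain ⟨γ, hγ, hγ1, n₀, hram⟩ := exists_isRamseyFor_of_isQuasirandom hk
  have : NeZero (16 * k) := ⟨by lia⟩
  obtain ⟨D, hD, hquasi⟩ := exists_isQuasirandom (16 * k) hγ
  push_cast at hquasi
  refine ⟨max n₀ D, fun n hn ↦ ?_⟩
  have hn0 : n₀ ≤ n := (le_max_left _ _).trans hn
  have hnD : D ≤ n := (le_max_right _ _).trans hn
  obtain ⟨V, hVf, G, hcard, hG⟩ := hquasi (800 * k ^ 2 * n / D + 1)
  have h1 : 800 * k ^ 2 * n ≤ Fintype.card V := by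
    rw [hcard]
    exact (Nat.lt_mul_div_succ _ hD).le
  have h2 : Fintype.card V ≤ 900 * k ^ 2 * n := by
    have h3 := Nat.mul_div_le (800 * k ^ 2 * n) D
    have h4 : n ≤ k ^ 2 * n := Nat.le_mul_of_pos_left _ (by positivity)
    rw [hcard, mul_add, mul_one]
    linarith
  refine ⟨V, hVf, G, hram V G n hn0 hG h1, ?_⟩
  have h5 := hG.ncard_edgeSet_le hγ1
  have h2' : (Fintype.card V : ℝ) ≤ 900 * k ^ 2 * n := by exact_mod_cast h2
  have hkpos : (0 : ℝ) < k := by exact_mod_cast (by lia : 0 < k)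
  have h6 : (G.edgeSet.ncard : ℝ) ≤ 10 ^ 5 * k ^ 3 * n ^ 2 := by
    calc (G.edgeSet.ncard : ℝ) ≤ 1 / (16 * k) * (900 * k ^ 2 * n) ^ 2 := h5.trans (by gcongr)
      _ = 50625 * (k ^ 3 * n ^ 2) := by field_simp; ring
      _ ≤ 10 ^ 5 * (k ^ 3 * n ^ 2) := by gcongr; norm_num
      _ = 10 ^ 5 * k ^ 3 * n ^ 2 := by ring
  exact_mod_cast h6

/-- The infimum of an empty set of naturals is 0, so lower bounds need some Ramsey graph to exist.
For small `n` one is borrowed from a larger starburst. -/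
theorem exists_isRamseyFor_ncard_eq_sizeRamsey_starburst {k : ℕ} (hk : 2 ≤ k) (n : ℕ) :
    ∃ (N : ℕ) (G : SimpleGraph (Fin N)), IsRamseyFor G (starburst k n) ∧
      G.edgeSet.ncard = sizeRamsey (starburst k n) := by
  obtain ⟨n₀, h⟩ := exists_isRamseyFor_starburst hk
  obtain ⟨V, _, G, hG, -⟩ := h (max n n₀) (le_max_right _ _)
  exact exists_isRamseyFor_ncard_eq_sizeRamsey
    (hG.mono (starburst_isContained_starburst le_rfl (le_max_left _ _)))

theorem le_sizeRamsey_starburst {k : ℕ} (hk : 2 ≤ k) (n : ℕ) :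
    (k - 1).choose 2 * (n + k - 1) * (k * n + k - 1) ≤ sizeRamsey (starburst k n) := by
  obtain ⟨N, G, hG, hcard⟩ := exists_isRamseyFor_ncard_eq_sizeRamsey_starburst hk n
  exact hcard ▸ hG.le_ncard_edgeSet hk

theorem cube_mul_sq_le_sizeRamsey_starburst {k : ℕ} (hk : 2 ≤ k) (n : ℕ) :
    k ^ 3 * n ^ 2 ≤ 16 * sizeRamsey (starburst k n) := by
  -- The general bound is zero at `k = 2`; from `k = 3` on, `16 * (k - 1).choose 2 = 8 (k - 1)(k -
  -- 2)` is at least `k ^ 2`.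
  rcases hk.eq_or_lt with rfl | hk3
  · obtain ⟨N, G, hG, hcard⟩ := exists_isRamseyFor_ncard_eq_sizeRamsey_starburst le_rfl n
    have := hG.le_two_mul_ncard_edgeSet
    rw [hcard] at this
    nlinarith
  · refine le_trans ?_ (Nat.mul_le_mul_left 16 (le_sizeRamsey_starburst hk n))
    obtain ⟨j, rfl⟩ : ∃ j, k = j + 3 := ⟨k - 3, by lia⟩
    have h1 : (j + 3 - 1).choose 2 * 2 = (j + 2) * (j + 1) := by
      rw [Nat.choose_two_right, Nat.div_mul_cancel (Nat.even_mul_pred_self _).two_dvd]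
      rfl
    have h2 : (j + 3) ^ 2 ≤ 16 * (j + 3 - 1).choose 2 := by nlinarith
    calc (j + 3) ^ 3 * n ^ 2 = (j + 3) ^ 2 * n * ((j + 3) * n) := by ring
      _ ≤ 16 * (j + 3 - 1).choose 2 * (n + (j + 3) - 1) * ((j + 3) * n + (j + 3) - 1) := by
          gcongr <;> lia
      _ = 16 * ((j + 3 - 1).choose 2 * (n + (j + 3) - 1) * ((j + 3) * n + (j + 3) - 1)) := by ring

end UpperBound

theorem mainTheorem4 :
    (∃ c C : ℝ, 0 < c ∧ 0 < C ∧ ∀ k : ℕ, 2 ≤ k → ∃ n₀ : ℕ, ∀ n : ℕ, n₀ ≤ n →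
      c * (k : ℝ) ^ 3 * (n : ℝ) ^ 2 ≤ (sizeRamsey (starburst k n) : ℝ) ∧
      (sizeRamsey (starburst k n) : ℝ) ≤ C * (k : ℝ) ^ 3 * (n : ℝ) ^ 2) ∧
    (∀ k : ℕ, 4 ≤ k → ∃ n₀ : ℕ, ∀ n : ℕ, n₀ ≤ n →
      sizeRamsey (starburst k n) ≤ 10 ^ 5 * k ^ 3 * n ^ 2) ∧
    (∀ k n : ℕ, 2 ≤ k → 1 ≤ n →
      (k - 1).choose 2 * (n + k - 1) * (k * n + k - 1) ≤ sizeRamsey (starburst k n)) := by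
  have upper : ∀ k : ℕ, 2 ≤ k → ∃ n₀ : ℕ, ∀ n : ℕ, n₀ ≤ n →
      sizeRamsey (starburst k n) ≤ 10 ^ 5 * k ^ 3 * n ^ 2 := by
    intro k hk
    obtain ⟨n₀, h⟩ := exists_isRamseyFor_starburst hk
    refine ⟨n₀, fun n hn ↦ ?_⟩
    obtain ⟨V, _, G, hG, hcard⟩ := h n hn
    exact (sizeRamsey_le hG).trans hcard
  refine ⟨⟨1 / 16, 10 ^ 5, by norm_num, by norm_num, fun k hk ↦ ?_⟩,
    fun k hk ↦ upper k (by lia), fun k n hk _ ↦ le_sizeRamsey_starburst hk n⟩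
  obtain ⟨n₀, h⟩ := upper k hk
  refine ⟨n₀, fun n hn ↦ ⟨?_, by exact_mod_cast h n hn⟩⟩
  have h1 : (k : ℝ) ^ 3 * (n : ℝ) ^ 2 ≤ 16 * sizeRamsey (starburst k n) := by
    exact_mod_cast cube_mul_sq_le_sizeRamsey_starburst hk n
  linarith
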